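/- Let $V$ be a finite set, let $P=(P_{xy})_{x,y\in V}$ be a sub-Markovian matrix ($P_{xy}\ge 0$ and $\sum_y P_{xy}\le 1$ for all $x,y$), and suppose that the Markov chain that jumps from $x$ to $y$ with probability $P_{xy}$ and is killed at $x$ with probability $1-\sum_y P_{xy}$ is transient, i.e. $\sum_{n\ge 0}(P^n)_{xy}<\infty$ for all $x,y\in V$. An unrooted loop $\gamma$ is a nonempty cyclic sequence $(x_1,\dots,x_n)$ of vertices, taken up to rotation, in which consecutive vertices (including $x_n,x_1$) are adjacent, where $x,y$ are adjacent if $P_{xy}\ne 0$ or $P_{yx}\neq 0$. Its multiplicity $J(\gamma)$ is the largest $J$ such that $\gamma$ is the concatenation of $J$ identical loops. The loop measure $\mu$ is the measure on the countable set of unrooted loops with $\mu(\{\gamma\})=P_{x_1x_2}\cdots P_{x_{n-1}x_n}P_{x_nx_1}/J(\gamma)$. For $\alpha>0$, let the oriented loop soup $\mathcal L_\alpha$ be a Poisson point process on unrooted loops with intensity measure $\alpha\mu$, and for $x\in V$ let $\theta_x$ be the sum, over the loops of $\mathcal L_\alpha$ counted with repetition, of the number of visits of the loop at $x$. Then $\theta=(\theta_x)_{x\in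 V}$ is a permanental random field with parameter $(\alpha^{-1},P)$; namely, it is almost surely $\mathbb N^V$-valued, where $\mathbb N=\{0,1,2,\dots\}$, and for every $\mathbf q=(q_x)_{x\in V}\in\mathbb N^V$, $$\mathbb P(\theta=\mathbf q)=\det(I-P)^{\alpha}\cdot\frac{\mathrm{per}_\alpha(P[\mathbf q])}{\prod_{x\in V}q_x!}.$$ Here $P[\mathbf q]$ is the square matrix of order $\sum_x q_x$ obtained from $P$ by repeating each index $x$ exactly $q_x$ times, and for a $d\times d$ matrix $A$, $\mathrm{per}_\alpha(A)=\sum_{\pi\in S_d}\alpha^{\#(\pi)}\prod_{i=1}^d A_{i,\pi(i)}$, where $\#(\pi)$ is the number of disjoint cycles of $\pi$, fixed points included. -/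

import Mathlib

open MeasureTheory ProbabilityTheory
open scoped ENNReal

namespace LoopSoup

/-! ### The `α`-permanent and block matrices -/

/-- The number of disjoint cycles of a permutation (every fixed point is a cycle of length one). -/
def numCycles {ι : Type*} [Fintype ι] [DecidableEq ι] (π : Equiv.Perm ι) : ℕ :=
  Multiset.card π.partition.parts

/-- The `α`-permanent of a square real matrix. -/
def alphaPermanent {ι : Type*} [Fintype ι] [DecidableEq ι] (α : ℝ) (A : Matrix ι ι ℝ) : ℝ :=
  ∑ π : Equiv.Perm ι, α ^ numCycles π * ∏ i, A i (π i)

/-- The block matrix `A[q]`, in which the index `x` is repeated `q x` times. -/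
def blockMatrix {V : Type*} (A : Matrix V V ℝ) (q : V → ℕ) :
    Matrix (Σ x : V, Fin (q x)) (Σ x : V, Fin (q x)) ℝ :=
  A.submatrix Sigma.fst Sigma.fst

/-! ### Transient sub-Markovian matrices -/

/-- Nonnegative entries and row sums at most one; the chain at `x` jumps to `y` with probability
`P x y` and is killed with the remaining probability. -/
def IsSubMarkovian {V : Type*} [Fintype V] (P : Matrix V V ℝ) : Prop :=
  (∀ x y, 0 ≤ P x y) ∧ ∀ x, ∑ y, P x y ≤ 1

/-- The Green function: the expected number of visits to `y` before killing of the chain started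
at `x`, the chain being at `y` at time `n` with probability `(P ^ n) x y`. -/
noncomputable def greenFunction {V : Type*} [Fintype V] [DecidableEq V] (P : Matrix V V ℝ)
    (x y : V) : ℝ≥0∞ :=
  ∑' n : ℕ, ENNReal.ofReal ((P ^ n) x y)

/-- The killed Markov chain with transition matrix `P` is transient. -/
def IsTransient {V : Type*} [Fintype V] [DecidableEq V] (P : Matrix V V ℝ) : Prop :=
  ∀ x y, greenFunction P x y < ∞

/-! ### Unrooted oriented loops -/

/-- Adjacency in the graph of `P` (self-loops allowed). -/
def GraphAdj {V : Type*} (P : Matrix V V ℝ) (x y : V) : Prop :=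
  P x y ≠ 0 ∨ P y x ≠ 0

/-- The unrooted oriented loops on the graph of `P`: nonempty cyclic sequences `x₁, …, xₙ` of
vertices, up to rotation, in which `x₁, x₂`, …, `xₙ₋₁, xₙ` and `xₙ, x₁` are adjacent.
For `n = 1` this is the loop that crosses the edge from `x₁` to itself once. -/
def UnrootedLoop {V : Type*} (P : Matrix V V ℝ) : Type _ :=
  {c : Cycle V // c ≠ Cycle.nil ∧ c.Chain (GraphAdj P)}

/-- The space of unrooted loops is countable; it carries the discrete σ-algebra. -/
instance {V : Type*} (P : Matrix V V ℝ) : MeasurableSpace (UnrootedLoop P) := ⊤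

/-- The oriented edges `(x₁, x₂), …, (xₙ₋₁, xₙ), (xₙ, x₁)` crossed by the cyclic sequence
`x₁, …, xₙ`, with multiplicity. -/
def crossings {V : Type*} (c : Cycle V) : Multiset (V × V) :=
  Quotient.liftOn' c (fun l => (List.zip l (l.rotate 1) : Multiset (V × V))) (by
    rintro l₁ l₂ ⟨n, rfl⟩
    have h : List.zip (l₁.rotate n) ((l₁.rotate n).rotate 1)
        = (List.zip l₁ (l₁.rotate 1)).rotate n := by
      rw [List.rotate_rotate, Nat.add_comm n 1, ← List.rotate_rotate]
      exact (List.zipWith_rotate_distrib Prod.mk l₁ (l₁.rotate 1) n (by simp)).symm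
    refine Multiset.coe_eq_coe.2 ?_
    rw [h]
    exact (List.rotate_perm _ n).symm)

namespace UnrootedLoop

/-- The number of visits of a loop at the vertex `x`. -/
def visits {V : Type*} [DecidableEq V] {P : Matrix V V ℝ} (γ : UnrootedLoop P) (x : V) : ℕ :=
  γ.1.toMultiset.count x

/-- The multiplicity of a loop: the largest `J` such that the loop is the concatenation of `J`
identical loops. -/
noncomputable def multiplicity {V : Type*} {P : Matrix V V ℝ} (γ : UnrootedLoop P) : ℕ :=
  sSup {J : ℕ | ∃ l : List V, (((List.replicate J l).flatten : List V) : Cycle V) = γ.1}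

/-- The mass of a loop: the product of the transition probabilities of the edges that it crosses,
divided by its multiplicity. -/
noncomputable def mass {V : Type*} {P : Matrix V V ℝ} (γ : UnrootedLoop P) : ℝ :=
  ((crossings γ.1).map fun e => P e.1 e.2).prod / (γ.multiplicity : ℝ)

end UnrootedLoop

/-- The loop measure: the measure on unrooted loops that gives each `{γ}` the mass of `γ`. -/
noncomputable def loopMeasure {V : Type*} (P : Matrix V V ℝ) : Measure (UnrootedLoop P) :=
  Measure.sum fun γ : UnrootedLoop P => ENNReal.ofReal γ.mass • Measure.dirac γ

/-! ### Poisson point processes and the loop soup -/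

/-- The Poisson distribution with parameter `r ∈ [0, ∞]`, as a law on `[0, ∞]`; for `r = ∞` it is
the unit mass at `∞`. -/
noncomputable def poissonLaw (r : ℝ≥0∞) : Measure ℝ≥0∞ :=
  if r = ∞ then Measure.dirac ∞ else (poissonMeasure r.toNNReal).map fun n : ℕ => (n : ℝ≥0∞)

/-- `N` is a Poisson point process on `E` with intensity measure `ν`, defined on `(Ω, Pr)`: a random
measure such that the number `N B` of points in a measurable set `B` is Poisson distributed with
parameter `ν B`, and the numbers of points in disjoint measurable sets are independent. -/
structure IsPoissonPointProcess {Ω E : Type*} [MeasurableSpace Ω] [MeasurableSpace E]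
    (Pr : Measure Ω) (ν : Measure E) (N : Ω → Measure E) : Prop where
  measurable : Measurable N
  law : ∀ B : Set E, MeasurableSet B → Pr.map (fun ω => N ω B) = poissonLaw (ν B)
  indep : ∀ (n : ℕ) (B : Fin n → Set E), (∀ i, MeasurableSet (B i)) →
    Pairwise (fun i j => Disjoint (B i) (B j)) → iIndepFun (fun i ω => N ω (B i)) Pr

/-- `L` is an oriented loop soup of intensity `α` associated with `P`: a Poisson point process of
unrooted loops with intensity `α` times the loop measure. -/
def IsLoopSoup {Ω V : Type*} [MeasurableSpace Ω] (Pr : Measure Ω) (α : ℝ) (P : Matrix V V ℝ)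
    (L : Ω → Measure (UnrootedLoop P)) : Prop :=
  IsPoissonPointProcess Pr (ENNReal.ofReal α • loopMeasure P) L

/-- The occupation field on vertices: the sum over the loops of the configuration `L ω`, with
repetition, of their numbers of visits at `x`. -/
noncomputable def occupation {Ω V : Type*} [DecidableEq V] {P : Matrix V V ℝ}
    (L : Ω → Measure (UnrootedLoop P)) (x : V) (ω : Ω) : ℝ≥0∞ :=
  ∫⁻ γ, (γ.visits x : ℝ≥0∞) ∂(L ω)

/-- `θ` is a permanental random field on `V` with parameter `(a, P)`: an almost surely
`ℕ`-valued random field with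
`Pr (θ = q) = det (I - P) ^ a⁻¹ * per_{a⁻¹} (P[q]) / ∏ x, (q x)!` for all `q`. -/
def IsPermanentalField {Ω V : Type*} [MeasurableSpace Ω] [Fintype V] [DecidableEq V]
    (Pr : Measure Ω) (θ : V → Ω → ℝ≥0∞) (a : ℝ) (P : Matrix V V ℝ) : Prop :=
  (∀ x, Measurable (θ x)) ∧
  (∀ᵐ ω ∂Pr, ∃ q : V → ℕ, ∀ x, θ x ω = (q x : ℝ≥0∞)) ∧
  ∀ q : V → ℕ, Pr.real {ω | ∀ x, θ x ω = (q x : ℝ≥0∞)} =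
    (1 - P).det ^ a⁻¹ *
      (alphaPermanent a⁻¹ (blockMatrix P q) / ∏ x, (Nat.factorial (q x) : ℝ))

end LoopSoup

/-! Both sides of the formula solve the same recursion in `q`, which determines a solution up to its
value at `q = 0`. On the probabilistic side, the Mecke equation (Chen–Stein at each loop) says that
weighting by a visit of the soup at `x` amounts to adding an independent loop with a marked visit at
`x`. Since a loop `γ` has `visits / multiplicity` distinct roots at `x`, these marked loops are
closed paths based at `x`, weighted by products of entries of `P` (`tsum_mass_mul_visits`). Hence `q
x * Pr (θ = q)` is `α` times a sum over such paths (`IsLoopSoup.shiftedLaw_recursion`), and opening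
the closed paths into paths from `x` to `y` makes a first-step decomposition possible. On the
algebraic side, removing an index from its cycle expands the `α`-permanent along a row
(`alphaPermanent_option`). Following the cycle through one distinguished index gives the same
first-step decomposition (`borderedPermanent_eq`), the factorials absorbing the number of copies of
each vertex. `eq_blockWeight_of_recursion` compares the two sides. The remaining constant is the
probability that the soup is empty, `exp (-α * μ(all loops))`. The total mass of `μ` is `∑ tr (P ^
n) / n` over `n ≥ 1`, which equals `-log det (1 - P)` (`det_one_sub_eq_exp`). -/

namespace LoopSoup

/-! ### Cycle counts under insertion of a point. -/

section NumCycles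

open Equiv Equiv.Perm

/-- The partition of `π` is its cycle type padded with one part per fixed point. The additive form
avoids truncated subtraction and lets `omega` settle the later cycle counts. -/
lemma numCycles_add_card_support {ι : Type*} [Fintype ι] [DecidableEq ι] (π : Perm ι) :
    numCycles π + π.support.card = Multiset.card π.cycleType + Fintype.card ι := by
  have h : π.support.card ≤ Fintype.card ι := Finset.card_le_univ _
  rw [numCycles, Perm.parts_partition, Multiset.card_add, Multiset.card_replicate]
  omega

lemma numCycles_optionCongr {ι : Type*} [Fintype ι] [DecidableEq ι] (σ : Perm ι) :
    numCycles (optionCongr σ) = numCycles σ + 1 := by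
  have h : optionCongr σ = σ.extendDomain (optionIsSomeEquiv ι).symm := by
    ext1 i
    cases i with
    | none => rw [Perm.extendDomain_apply_not_subtype _ _ (by simp)]; rfl
    | some i =>
      have := Perm.extendDomain_apply_image σ (optionIsSomeEquiv ι).symm i
      simpa using this.symm
  have h₁ := numCycles_add_card_support σ
  have h₂ := numCycles_add_card_support (optionCongr σ)
  rw [Fintype.card_option] at h₂
  rw [h, Perm.cycleType_extendDomain, Perm.card_support_extend_domain, ← h] at h₂
  omega

/-- Inserting a fixed point into a cycle merges two cycles. -/
lemma numCycles_swap_mul {ι : Type*} [Fintype ι] [DecidableEq ι] (τ : Perm ι) {a b : ι}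
    (hab : a ≠ b) (ha : τ a = a) : numCycles (swap a b * τ) + 1 = numCycles τ := by
  have h₁ := numCycles_add_card_support τ
  have h₂ := numCycles_add_card_support (swap a b * τ)
  by_cases hb : τ b = b
  · have hd : Disjoint (swap a b) τ := by
      rw [disjoint_iff_disjoint_support, support_swap hab]
      simp [ha, hb]
    rw [hd.cycleType_mul, hd.card_support_mul, card_support_swap hab,
      (isCycle_swap hab).cycleType] at h₂
    simp at h₂
    omega
  · set c := τ.cycleOf b with hc
    set ρ := c⁻¹ * τ with hρ
    have hb' : b ∈ τ.support := mem_support.2 hb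
    have hcτ : c ∈ τ.cycleFactorsFinset := cycleOf_mem_cycleFactorsFinset_iff.2 hb'
    have hτ : c * ρ = τ := by simp [hρ]
    have hdis : Disjoint c ρ := by
      have := disjoint_mul_inv_of_mem_cycleFactorsFinset hcτ
      have h3 : ρ = τ * c⁻¹ := by
        have := self_mem_cycle_factors_commute hcτ
        rw [hρ]
        exact (this.inv_left).eq
      rw [h3]; exact this.symm
    obtain ⟨t, ht⟩ : ∃ t, toList τ b = b :: t := by
      have : toList τ b ≠ [] := by rw [Ne, toList_eq_nil_iff]; simpa using hb
      obtain ⟨y, t, hyt⟩ := List.exists_cons_of_ne_nil this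
      have h0 : (toList τ b)[0]'(by simp [hyt]) = b := by simp [getElem_toList]
      refine ⟨t, ?_⟩
      rw [hyt]
      simp only [hyt, List.getElem_cons_zero] at h0
      rw [h0]
    have hnd : (b :: t).Nodup := ht ▸ nodup_toList τ b
    have hform : c = (b :: t).formPerm := by rw [← ht, formPerm_toList]
    have hcsupp : c.support = (b :: t).toFinset := by
      rw [← ht]; ext y
      rw [List.mem_toFinset, mem_toList_iff, hc, mem_support_cycleOf_iff]
    have hat : a ∉ (b :: t) := by
      rw [← List.mem_toFinset, ← hcsupp, hc, mem_support_cycleOf_iff]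
      rintro ⟨h, _⟩
      exact hab ((h.symm.eq_of_left ha))
    have hnd' : (a :: b :: t).Nodup := List.nodup_cons.2 ⟨hat, hnd⟩
    have hform' : swap a b * c = (a :: b :: t).formPerm := by
      rw [hform, List.formPerm_cons_cons]
    have hcyc' : (swap a b * c).IsCycle := by
      rw [hform']; exact List.isCycle_formPerm hnd' (by simp)
    have hsupp' : (swap a b * c).support = insert a c.support := by
      rw [hform', List.support_formPerm_of_nodup _ hnd' (by simp), hcsupp, List.toFinset_cons]
    have hac : a ∉ c.support := by rw [hcsupp, List.mem_toFinset]; exact hat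
    have hρa : ρ a = a := by
      have : c a = a := by simpa using hac
      rw [hρ, Perm.mul_apply, ha, Perm.inv_eq_iff_eq, this]
    have hdis' : Disjoint (swap a b * c) ρ := by
      rw [disjoint_iff_disjoint_support, hsupp', Finset.disjoint_insert_left]
      exact ⟨by simpa using hρa, disjoint_iff_disjoint_support.1 hdis⟩
    have hcc : c.IsCycle := isCycle_cycleOf τ hb
    rw [← hτ, ← mul_assoc, hdis'.cycleType_mul, hdis'.card_support_mul, hsupp',
      Finset.card_insert_of_notMem hac, hcyc'.cycleType] at h₂
    rw [← hτ, hdis.cycleType_mul, hdis.card_support_mul, hcc.cycleType] at h₁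
    rw [← hτ, ← mul_assoc]
    simp at h₁ h₂
    omega

lemma numCycles_swap_none_mul_optionCongr {ι : Type*} [Fintype ι] [DecidableEq ι] (σ : Perm ι)
    (k : ι) : numCycles (swap none (some k) * optionCongr σ) = numCycles σ := by
  have := numCycles_swap_mul (optionCongr σ) (a := none) (b := some k) (by simp) (by simp)
  rw [numCycles_optionCongr] at this
  omega

lemma numCycles_permCongr {ι κ : Type*} [Fintype ι] [DecidableEq ι] [Fintype κ] [DecidableEq κ]
    (e : ι ≃ κ) (σ : Perm ι) : numCycles (e.permCongr σ) = numCycles σ := by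
  have h : σ.extendDomain (e.trans (Equiv.Set.univ κ).symm : ι ≃ {x : κ // x ∈ Set.univ}) =
      e.permCongr σ := by
    ext1 y
    obtain ⟨i, rfl⟩ := e.surjective y
    have := Perm.extendDomain_apply_image σ
      (e.trans (Equiv.Set.univ κ).symm : ι ≃ {x : κ // x ∈ Set.univ}) i
    simpa using this
  have h₁ := numCycles_add_card_support σ
  have h₂ := numCycles_add_card_support (e.permCongr σ)
  rw [← Fintype.card_congr e] at h₂
  rw [← h, Perm.cycleType_extendDomain, Perm.card_support_extend_domain, h] at h₂
  omega

end NumCycles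

/-! ### Row expansion of the `α`-permanent. -/

section AlphaPermanent

open Equiv

lemma alphaPermanent_submatrix_equiv {ι κ : Type*} [Fintype ι] [DecidableEq ι] [Fintype κ]
    [DecidableEq κ] (α : ℝ) (A : Matrix κ κ ℝ) (e : ι ≃ κ) :
    alphaPermanent α (A.submatrix e e) = alphaPermanent α A := by
  unfold alphaPermanent
  refine Fintype.sum_equiv e.permCongr _ _ fun σ => ?_
  rw [numCycles_permCongr]
  congr 1
  refine Fintype.prod_equiv e _ _ fun i => ?_
  simp

/-- Expansion of the `α`-permanent along the row of `none`, the image of `none` being removed from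
its cycle. -/
lemma alphaPermanent_option {ι : Type*} [Fintype ι] [DecidableEq ι] (α : ℝ)
    (A : Matrix (Option ι) (Option ι) ℝ) :
    alphaPermanent α A = α * A none none * alphaPermanent α (A.submatrix some some) +
      ∑ k : ι, A none (some k) *
        alphaPermanent α (A.submatrix some (Function.update some k none)) := by
  unfold alphaPermanent
  -- A permutation of `Option ι` is the image of `none` together with a permutation of `ι`. If
  -- `none` is fixed it is an extra cycle, whence the factor `α`; otherwise no cycle is added.
  rw [← (Perm.decomposeOption (α := ι)).symm.sum_comp, Fintype.sum_prod_type, Fintype.sum_option]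
  congr 1
  · rw [Finset.mul_sum]
    refine Finset.sum_congr rfl fun σ _ => ?_
    simp only [Perm.decomposeOption_symm_apply, swap_self, Fintype.prod_option]
    rw [← Equiv.Perm.one_def, one_mul, numCycles_optionCongr]
    simp
    ring
  · refine Finset.sum_congr rfl fun k _ => ?_
    rw [Finset.mul_sum]
    refine Finset.sum_congr rfl fun σ _ => ?_
    simp only [Perm.decomposeOption_symm_apply, Fintype.prod_option]
    rw [numCycles_swap_none_mul_optionCongr]
    -- `none` is spliced into the cycle just before `k`: the predecessor of `k` now points to
    -- `none`, so column `none` takes the place of column `k`.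
    have : ∀ i, (swap none (some k) * optionCongr σ) (some i) =
        Function.update some k none (σ i) := by
      intro i
      by_cases h : σ i = k
      · simp [h]
      · simp [h, swap_apply_of_ne_of_ne]
    simp only [this]
    simp
    ring

end AlphaPermanent

/-! ### Bordered block permanents and the recursion that characterizes them. -/

section PathPermanent

lemma exists_equiv_of_card_fiber_eq {V A B : Type*} [DecidableEq V] [Fintype A] [Fintype B] (f : A → V)
    (g : B → V) (h : ∀ v, Fintype.card {a // f a = v} = Fintype.card {b // g b = v}) :
    ∃ e : A ≃ B, ∀ a, g (e a) = f a := by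
  refine ⟨(Equiv.sigmaFiberEquiv f).symm.trans
    ((Equiv.sigmaCongrRight fun v => Fintype.equivOfCardEq (h v)).trans
      (Equiv.sigmaFiberEquiv g)), fun a => ?_⟩
  exact (Fintype.equivOfCardEq (h (f a)) ⟨a, rfl⟩).2

variable {V : Type*} [Fintype V] [DecidableEq V]

/-- The index set of `A[q]` is that of `A[q - δ_z]` with one more index in the block of `z`. -/
lemma exists_option_equiv_block (q : V → ℕ) (z : V) (hz : 0 < q z) :
    ∃ e : Option (Σ x : V, Fin ((q - Pi.single z 1 : V → ℕ) x)) ≃ Σ x : V, Fin (q x),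
      ∀ i, (e i).1 = i.elim z Sigma.fst := by
  refine exists_equiv_of_card_fiber_eq (fun i => Option.elim i z Sigma.fst) Sigma.fst fun v => ?_
  have hsum : ∀ r : V → ℕ, (∑ x, ∑ _i : Fin (r x), if x = v then 1 else 0) = r v := by
    intro r
    simp only [Finset.sum_const, Finset.card_univ, Fintype.card_fin, smul_eq_mul, mul_ite, mul_one,
      mul_zero, Finset.sum_ite_eq', Finset.mem_univ, if_true]
  simp only [Fintype.card_subtype, Finset.card_filter, Fintype.sum_option, Fintype.sum_sigma]
  refine Eq.trans ?_ (hsum q).symm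
  refine (congrArg ((if z = v then 1 else 0) + ·)
    (hsum (q - Pi.single z 1 : V → ℕ))).trans ?_
  by_cases h : z = v
  · subst h
    simp only [if_true, Pi.sub_apply, Pi.single_eq_same]
    omega
  · simp [h, Ne.symm h]

/-- The `α`-permanent of `A[q]` bordered by an additional row of type `x` and an additional column
of type `y`, which are matched with each other. -/
def borderedPermanent (α : ℝ) (P : Matrix V V ℝ) (x y : V) (q : V → ℕ) : ℝ :=
  alphaPermanent α (Matrix.of fun i j : Option (Σ x : V, Fin (q x)) =>
    P (i.elim x Sigma.fst) (j.elim y Sigma.fst))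

lemma alphaPermanent_blockMatrix_eq_bordered (α : ℝ) (P : Matrix V V ℝ) (q : V → ℕ) (x : V)
    (hx : 0 < q x) :
    alphaPermanent α (blockMatrix P q) = borderedPermanent α P x x (q - Pi.single x 1) := by
  obtain ⟨e, he⟩ := exists_option_equiv_block q x hx
  rw [← alphaPermanent_submatrix_equiv α (blockMatrix P q) e, borderedPermanent]
  congr 1
  ext i j
  simp [blockMatrix, he]

/-- Row `k` and the modified column `k` become the additional row and column, of types `k.1` and
`y`. -/
lemma alphaPermanent_update_eq_bordered (α : ℝ) (P : Matrix V V ℝ) (q : V → ℕ) (y : V)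
    (k : Σ x : V, Fin (q x)) :
    alphaPermanent α (Matrix.of fun i j : Σ x : V, Fin (q x) =>
      P i.1 (if j = k then y else j.1)) =
      borderedPermanent α P k.1 y (q - Pi.single k.1 1) := by
  obtain ⟨e, he⟩ := exists_option_equiv_block q k.1 (Fin.pos k.2)
  -- `e none` is some copy of the vertex `k.1`, not necessarily `k`; a swap inside the block
  -- corrects this without changing any type.
  have hsw : ∀ i, (Equiv.swap (e none) k i).1 = i.1 := by
    intro i
    rw [Equiv.swap_apply_def]
    split_ifs with h1 h2
    · rw [h1, he]; rfl
    · rw [h2, he]; rfl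
    · rfl
  set e' := e.trans (Equiv.swap (e none) k) with he'
  have h1 : ∀ i, (e' i).1 = i.elim k.1 Sigma.fst := fun i => by simp [he', hsw, he]
  have h2 : e' none = k := by simp [he']
  rw [← alphaPermanent_submatrix_equiv α _ e', borderedPermanent]
  congr 1
  ext i j
  simp only [Matrix.submatrix_apply, Matrix.of_apply, h1]
  cases j with
  | none => simp [h2]
  | some j =>
    rw [if_neg]
    · simp
    · intro h
      exact Option.some_ne_none j (e'.injective (h.trans h2.symm))

/-- First-step decomposition of the cycle through the additional index. -/
lemma borderedPermanent_eq (α : ℝ) (P : Matrix V V ℝ) (x y : V) (q : V → ℕ) :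
    borderedPermanent α P x y q = α * P x y * alphaPermanent α (blockMatrix P q) +
      ∑ z, q z * P x z * borderedPermanent α P z y (q - Pi.single z 1) := by
  rw [borderedPermanent, alphaPermanent_option]
  congr 1
  rw [Fintype.sum_sigma]
  refine Finset.sum_congr rfl fun z _ => ?_
  have : ∀ k : Fin (q z), alphaPermanent α ((Matrix.of fun i j : Option (Σ x : V, Fin (q x)) =>
      P (i.elim x Sigma.fst) (j.elim y Sigma.fst)).submatrix some
        (Function.update some ⟨z, k⟩ none)) =
      borderedPermanent α P z y (q - Pi.single z 1) := by
    intro k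
    rw [← alphaPermanent_update_eq_bordered α P q y ⟨z, k⟩]
    congr 1
    ext i j
    by_cases h : j = ⟨z, k⟩
    · simp [h]
    · simp [h, Function.update_of_ne]
  simp only [this]
  simp
  ring

/-- The normalized `α`-permanent of `P[q]`. -/
noncomputable def blockWeight (α : ℝ) (P : Matrix V V ℝ) (q : V → ℕ) : ℝ :=
  alphaPermanent α (blockMatrix P q) / ∏ x, (Nat.factorial (q x) : ℝ)

/-- The normalized bordered `α`-permanent. -/
noncomputable def borderedWeight (α : ℝ) (P : Matrix V V ℝ) (x y : V) (q : V → ℕ) : ℝ :=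
  borderedPermanent α P x y q / ∏ x, (Nat.factorial (q x) : ℝ)

lemma prod_factorial_sub_single (q : V → ℕ) (z : V) (hz : 0 < q z) :
    (∏ x, (Nat.factorial (q x) : ℝ)) =
      q z * ∏ x, (Nat.factorial ((q - Pi.single z 1 : V → ℕ) x) : ℝ) := by
  have h₁ := Finset.mul_prod_erase Finset.univ (fun x => (Nat.factorial (q x) : ℝ))
    (Finset.mem_univ z)
  have h₂ := Finset.mul_prod_erase Finset.univ
    (fun x => (Nat.factorial ((q - Pi.single z 1 : V → ℕ) x) : ℝ)) (Finset.mem_univ z)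
  rw [← h₁, ← h₂, ← mul_assoc]
  congr 1
  · simp only [Pi.sub_apply, Pi.single_eq_same]
    rw [← Nat.mul_factorial_pred hz.ne']
    push_cast; rfl
  · refine Finset.prod_congr rfl fun x hx => ?_
    simp [Pi.single_eq_of_ne (Finset.ne_of_mem_erase hx)]

lemma blockWeight_recursion (α : ℝ) (P : Matrix V V ℝ) (q : V → ℕ) (x : V) (hx : 0 < q x) :
    q x * blockWeight α P q = borderedWeight α P x x (q - Pi.single x 1) := by
  rw [blockWeight, borderedWeight, alphaPermanent_blockMatrix_eq_bordered α P q x hx,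
    prod_factorial_sub_single q x hx]
  have : (q x : ℝ) ≠ 0 := by positivity
  have h2 : (∏ z, (Nat.factorial ((q - Pi.single x 1 : V → ℕ) z) : ℝ)) ≠ 0 :=
    Finset.prod_ne_zero_iff.2 fun z _ => by positivity
  field_simp

/-- The `q z` equal terms coming from the copies of `z` turn the factorials of `q` into those of `q
- δ_z`. The condition `0 < q z` guards against truncated subtraction. -/
lemma borderedWeight_recursion (α : ℝ) (P : Matrix V V ℝ) (x y : V) (q : V → ℕ) :
    borderedWeight α P x y q = α * P x y * blockWeight α P q +
      ∑ z, if 0 < q z then P x z * borderedWeight α P z y (q - Pi.single z 1) else 0 := by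
  rw [borderedWeight, borderedPermanent_eq, add_div, blockWeight, mul_div_assoc]
  congr 1
  rw [Finset.sum_div]
  refine Finset.sum_congr rfl fun z _ => ?_
  split_ifs with hz
  · rw [borderedWeight, prod_factorial_sub_single q z hz]
    have : (q z : ℝ) ≠ 0 := by positivity
    have h2 : (∏ x, (Nat.factorial ((q - Pi.single z 1 : V → ℕ) x) : ℝ)) ≠ 0 :=
      Finset.prod_ne_zero_iff.2 fun z _ => by positivity
    field_simp
  · simp [Nat.eq_zero_of_not_pos hz]

lemma alphaPermanent_nonneg {ι : Type*} [Fintype ι] [DecidableEq ι] {α : ℝ} (hα : 0 ≤ α)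
    {A : Matrix ι ι ℝ} (hA : ∀ i j, 0 ≤ A i j) : 0 ≤ alphaPermanent α A :=
  Finset.sum_nonneg fun _ _ => mul_nonneg (pow_nonneg hα _) (Finset.prod_nonneg fun _ _ => hA _ _)

lemma blockWeight_nonneg {α : ℝ} (hα : 0 ≤ α) {P : Matrix V V ℝ} (hP : ∀ x y, 0 ≤ P x y)
    (q : V → ℕ) : 0 ≤ blockWeight α P q :=
  div_nonneg (alphaPermanent_nonneg hα fun _ _ => hP _ _)
    (Finset.prod_nonneg fun _ _ => by positivity)

lemma borderedWeight_nonneg {α : ℝ} (hα : 0 ≤ α) {P : Matrix V V ℝ} (hP : ∀ x y, 0 ≤ P x y)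
    (x y : V) (q : V → ℕ) : 0 ≤ borderedWeight α P x y q :=
  div_nonneg (alphaPermanent_nonneg hα fun _ _ => hP _ _)
    (Finset.prod_nonneg fun _ _ => by positivity)

lemma blockWeight_zero (α : ℝ) (P : Matrix V V ℝ) : blockWeight α P 0 = 1 := by
  have : IsEmpty (Σ x : V, Fin ((0 : V → ℕ) x)) := ⟨fun i => i.2.elim0⟩
  have h : numCycles (default : Equiv.Perm (Σ x : V, Fin ((0 : V → ℕ) x))) = 0 := by
    have := numCycles_add_card_support (default : Equiv.Perm (Σ x : V, Fin ((0 : V → ℕ) x)))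
    rw [show (default : Equiv.Perm (Σ x : V, Fin ((0 : V → ℕ) x))) = 1 from Subsingleton.elim _ _]
      at this ⊢
    simpa using this
  rw [blockWeight, alphaPermanent, Fintype.sum_unique, h]
  simp

/-- The recursion satisfied by normalized permanents has only one solution up to a constant. -/
lemma eq_blockWeight_of_recursion {α : ℝ} (hα : 0 ≤ α) {P : Matrix V V ℝ}
    (hP : ∀ x y, 0 ≤ P x y) (a : (V → ℕ) → ℝ≥0∞) (g : V → V → (V → ℕ) → ℝ≥0∞)
    (ha : ∀ q x, 0 < q x → q x * a q = g x x (q - Pi.single x 1))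
    (hg : ∀ x y q, g x y q = ENNReal.ofReal (α * P x y) * a q +
      ∑ z, if 0 < q z then ENNReal.ofReal (P x z) * g z y (q - Pi.single z 1) else 0)
    (q : V → ℕ) : a q = a 0 * ENNReal.ofReal (blockWeight α P q) := by
  suffices H : ∀ n : ℕ, ∀ q : V → ℕ, ∑ x, q x = n →
      a q = a 0 * ENNReal.ofReal (blockWeight α P q) ∧
      ∀ x y, g x y q = a 0 * ENNReal.ofReal (borderedWeight α P x y q) from (H _ q rfl).1
  intro n
  induction n with
  | zero =>
    intro q hq
    obtain rfl : q = 0 := by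
      ext x; exact (Finset.sum_eq_zero_iff.1 hq) x (Finset.mem_univ x)
    refine ⟨by simp [blockWeight_zero], fun x y => ?_⟩
    rw [hg, borderedWeight_recursion]
    simp [blockWeight_zero, mul_comm]
  | succ n ih =>
    intro q hq
    have hsub : ∀ z, 0 < q z → ∑ x, (q - Pi.single z 1 : V → ℕ) x = n := by
      intro z hz
      have h1 : ∑ x, (q - Pi.single z 1 : V → ℕ) x + ∑ x, (Pi.single z 1 : V → ℕ) x = n + 1 := by
        rw [← Finset.sum_add_distrib, ← hq]
        refine Finset.sum_congr rfl fun x _ => ?_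
        by_cases h : x = z
        · subst h; simp; omega
        · simp [Pi.single_eq_of_ne h]
      rw [Finset.sum_pi_single'] at h1
      simpa using h1
    -- `a` at this level comes from `g` one level below; `g` at this level then needs this value of
    -- `a`, so the order matters.
    have h1 : a q = a 0 * ENNReal.ofReal (blockWeight α P q) := by
      obtain ⟨x, hx⟩ : ∃ x, 0 < q x := by
        by_contra! h
        have : ∑ x, q x = 0 := Finset.sum_eq_zero fun x _ => Nat.le_zero.1 (h x)
        omega
      have h2 := ha q x hx
      rw [(ih _ (hsub x hx)).2 x x, ← blockWeight_recursion α P q x hx,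
        ENNReal.ofReal_mul (by positivity), ENNReal.ofReal_natCast, mul_left_comm] at h2
      refine (ENNReal.mul_right_inj ?_ (ENNReal.natCast_ne_top _)).1 h2
      simpa using hx.ne'
    refine ⟨h1, fun x y => ?_⟩
    rw [hg, borderedWeight_recursion, ENNReal.ofReal_add, ENNReal.ofReal_sum_of_nonneg, mul_add,
      ENNReal.ofReal_mul (mul_nonneg hα (hP x y)), h1, Finset.mul_sum]
    · congr 1
      · ring
      · refine Finset.sum_congr rfl fun z _ => ?_
        split_ifs with hz
        · rw [(ih _ (hsub z hz)).2 z y, ENNReal.ofReal_mul (hP x z)]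
          ring
        · simp
    · intro z _
      split_ifs
      · exact mul_nonneg (hP _ _) (borderedWeight_nonneg hα hP _ _ _)
      · rfl
    · exact mul_nonneg (mul_nonneg hα (hP x y)) (blockWeight_nonneg hα hP q)
    · refine Finset.sum_nonneg fun z _ => ?_
      split_ifs
      · exact mul_nonneg (hP _ _) (borderedWeight_nonneg hα hP _ _ _)
      · rfl

end PathPermanent

/-! ### Rotation periods, multiplicities and rootings of cyclic sequences. -/

section Rotation

variable {V : Type*}

/-- The smallest number of steps by which a nonempty list can be rotated onto itself. -/
noncomputable def rotPeriod (l : List V) : ℕ :=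
  Function.minimalPeriod (fun l : List V => l.rotate 1) l

lemma iterate_rotate_one (l : List V) (i : ℕ) :
    (fun l : List V => l.rotate 1)^[i] l = l.rotate i := by
  induction i with
  | zero => simp
  | succ i ih => rw [Function.iterate_succ_apply', ih, List.rotate_rotate]

lemma rotPeriod_dvd_iff {l : List V} {i : ℕ} : rotPeriod l ∣ i ↔ l.rotate i = l := by
  rw [rotPeriod, ← Function.isPeriodicPt_iff_minimalPeriod_dvd, Function.IsPeriodicPt,
    Function.IsFixedPt, iterate_rotate_one]

lemma rotPeriod_dvd_length (l : List V) : rotPeriod l ∣ l.length :=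
  rotPeriod_dvd_iff.2 (List.rotate_length l)

lemma rotPeriod_pos {l : List V} (hl : l ≠ []) : 0 < rotPeriod l :=
  Nat.pos_of_dvd_of_pos (rotPeriod_dvd_length l) (List.length_pos_of_ne_nil hl)

lemma rotate_eq_rotate_iff_modEq {l : List V} {i j : ℕ} :
    l.rotate i = l.rotate j ↔ i ≡ j [MOD rotPeriod l] := by
  wlog h : i ≤ j generalizing i j
  · rw [eq_comm, this (le_of_not_ge h), Nat.ModEq.comm]
  rw [Nat.modEq_iff_dvd' h, rotPeriod_dvd_iff]
  have : l.rotate j = (l.rotate (j - i)).rotate i := by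
    rw [List.rotate_rotate, Nat.sub_add_cancel h]
  rw [this, List.rotate_eq_rotate, eq_comm]

lemma rotPeriod_rotate (l : List V) (k : ℕ) : rotPeriod (l.rotate k) = rotPeriod l := by
  refine Nat.dvd_right_iff_eq.1 fun i => ?_
  rw [rotPeriod_dvd_iff, rotPeriod_dvd_iff, List.rotate_rotate, Nat.add_comm,
    ← List.rotate_rotate, List.rotate_eq_rotate]

/-- The second hypothesis is `d`-periodicity. It survives the removal of the first block, and it
makes the next block equal to the first. -/
lemma eq_flatten_replicate_take (d : ℕ) : ∀ (k : ℕ) (l : List V), l.length = k * d →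
    l.drop d = l.take (l.length - d) → l = (List.replicate k (l.take d)).flatten
  | 0, l, hl, _ => by simpa using hl
  | k + 1, l, hl, h => by
    have hlen : (l.drop d).length = k * d := by
      rw [List.length_drop, hl, Nat.succ_mul, Nat.add_sub_cancel]
    rcases Nat.eq_zero_or_pos k with rfl | hk
    · have : l.length = d := by simpa using hl
      simp [← this]
    · have hd : d ≤ l.length - d := by
        rw [hl, Nat.succ_mul, Nat.add_sub_cancel]
        exact Nat.le_mul_of_pos_left d hk
      have htake : (l.drop d).take d = l.take d := by
        rw [h, List.take_take, min_eq_left hd]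
      have hdrop : (l.drop d).drop d = (l.drop d).take ((l.drop d).length - d) := by
        conv_lhs => rw [h, List.drop_take]
        rw [List.length_drop]
      have ih := eq_flatten_replicate_take d k (l.drop d) hlen hdrop
      rw [htake] at ih
      rw [List.replicate_succ, List.flatten_cons, ← ih, List.take_append_drop]

/-- The initial segment of length `rotPeriod l` attains the maximum. Conversely, `J` copies of `p`
are invariant under rotation by `p.length`, so the period divides `p.length`. -/
lemma sSup_flatten_replicate_eq {l : List V} (hl : l ≠ []) :
    sSup {J : ℕ | ∃ p : List V, (((List.replicate J p).flatten : List V) : Cycle V) = l} =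
      l.length / rotPeriod l := by
  refine IsGreatest.csSup_eq ⟨⟨l.take (rotPeriod l), ?_⟩, ?_⟩
  · congr 1
    have hd := Nat.le_of_dvd (List.length_pos_of_ne_nil hl) (rotPeriod_dvd_length l)
    refine (eq_flatten_replicate_take _ _ l
      (Nat.div_mul_cancel (rotPeriod_dvd_length l)).symm ?_).symm
    have h := rotPeriod_dvd_iff.1 (dvd_refl (rotPeriod l))
    rw [List.rotate_eq_drop_append_take hd] at h
    have h' := congrArg (List.take (l.drop (rotPeriod l)).length) h
    rwa [List.take_left, List.length_drop] at h'
  · rintro J ⟨p, hp⟩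
    rw [Cycle.coe_eq_coe] at hp
    have hlen : J * p.length = l.length := by
      have := hp.perm.length_eq
      simpa using this
    rw [Nat.le_div_iff_mul_le (rotPeriod_pos hl)]
    have hpos : 0 < J * p.length := hlen ▸ List.length_pos_of_ne_nil hl
    rw [← hlen]
    refine Nat.mul_le_mul_left J (Nat.le_of_dvd (Nat.pos_of_mul_pos_left hpos) ?_)
    obtain ⟨m, hm⟩ := hp
    rw [← hm, rotPeriod_rotate, rotPeriod_dvd_iff]
    obtain ⟨K, rfl⟩ := Nat.exists_eq_succ_of_ne_zero (Nat.pos_of_mul_pos_right hpos).ne'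
    conv_lhs => rw [List.replicate_succ, List.flatten_cons, List.rotate_append_length_eq]
    rw [List.replicate_succ', List.flatten_concat]

lemma rotate_eq_cons_tail {x : V} {l₀ : List V} {i : ℕ} (hi : i < l₀.length)
    (h : l₀[i]? = some x) : l₀.rotate i = x :: (l₀.rotate i).tail := by
  rw [← List.head?_rotate hi] at h
  exact List.eq_cons_of_mem_head? h

variable [DecidableEq V]

/-- The lists `l` such that `x :: l` is a rotation of `l₀`. -/
def rootedTails (x : V) (l₀ : List V) : Finset (List V) :=
  ((Finset.range l₀.length).filter fun i => l₀[i]? = some x).image fun i => (l₀.rotate i).tail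

lemma mem_rootedTails {x : V} {l₀ l : List V} :
    l ∈ rootedTails x l₀ ↔ ((x :: l : List V) : Cycle V) = l₀ := by
  rw [rootedTails, Finset.mem_image, Cycle.coe_eq_coe]
  constructor
  · rintro ⟨i, hi, rfl⟩
    rw [Finset.mem_filter, Finset.mem_range] at hi
    rw [← rotate_eq_cons_tail hi.1 hi.2]
    exact (List.IsRotated.forall l₀ i)
  · intro h
    obtain ⟨i, hi⟩ := h.symm
    have hl₀ : l₀ ≠ [] := by rintro rfl; simp at hi
    have hlt : i % l₀.length < l₀.length := Nat.mod_lt _ (List.length_pos_of_ne_nil hl₀)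
    refine ⟨i % l₀.length, ?_, by rw [List.rotate_mod, hi]; rfl⟩
    rw [Finset.mem_filter, Finset.mem_range]
    refine ⟨hlt, ?_⟩
    rw [← List.head?_rotate hlt, List.rotate_mod, hi]; rfl

lemma card_filter_getElem?_eq (x : V) (l : List V) :
    ((Finset.range l.length).filter fun i => l[i]? = some x).card = l.count x := by
  rw [Finset.card_filter]
  induction l with
  | nil => simp
  | cons a l ih =>
    rw [List.length_cons, Finset.sum_range_succ', List.count_cons]
    simp only [List.getElem?_cons_succ, List.getElem?_cons_zero, ih, Option.some.injEq, beq_iff_eq]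

lemma card_filter_modEq {n d : ℕ} (hd : 0 < d) (h : d ∣ n) (j : ℕ) :
    ((Finset.range n).filter fun i => i ≡ j [MOD d]).card = n / d := by
  rw [← Nat.count_eq_card_filter_range, Nat.count_modEq_card n hd j, Nat.mod_eq_zero_of_dvd h]
  simp

/-- Each occurrence of `x` in `l₀` gives a tail, and two occurrences give the same one exactly when
they are congruent modulo the period; every fibre thus has `l₀.length / rotPeriod l₀` elements. -/
lemma card_rootedTails_mul (x : V) {l₀ : List V} (hl : l₀ ≠ []) :
    (rootedTails x l₀).card * (l₀.length / rotPeriod l₀) = l₀.count x := by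
  rw [← card_filter_getElem?_eq, Finset.card_eq_sum_card_image (fun i => (l₀.rotate i).tail),
    ← smul_eq_mul, ← Finset.sum_const]
  refine Finset.sum_congr rfl fun l hl' => ?_
  obtain ⟨j, hj, rfl⟩ := Finset.mem_image.1 hl'
  rw [Finset.mem_filter, Finset.mem_range] at hj
  rw [← card_filter_modEq (rotPeriod_pos hl) (rotPeriod_dvd_length l₀) j]
  congr 1
  ext i
  simp only [Finset.mem_filter, Finset.mem_range]
  rw [← rotate_eq_rotate_iff_modEq]
  constructor
  · rintro ⟨hi, h⟩
    have h1 := rotate_eq_cons_tail hj.1 hj.2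
    refine ⟨⟨hi, ?_⟩, by rw [h]⟩
    rw [← List.head?_rotate hi, h, h1]; rfl
  · rintro ⟨⟨hi, hx⟩, ht⟩
    refine ⟨hi, ?_⟩
    rw [rotate_eq_cons_tail hi hx, ht, ← rotate_eq_cons_tail hj.1 hj.2]

end Rotation

/-! ### Sums over paths and powers of `P`. -/

section PathWeight

variable {V : Type*}

/-- The weight of the path that starts at `x`, visits the vertices of the list and ends at `y`. -/
def pathWeight (P : Matrix V V ℝ) : V → List V → V → ℝ
  | x, [], y => P x y
  | x, z :: l, y => P x z * pathWeight P z l y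

lemma prod_zip_eq_pathWeight (P : Matrix V V ℝ) (l : List V) (x y : V) :
    ((List.zip (x :: l) (l ++ [y])).map fun e => P e.1 e.2).prod = pathWeight P x l y := by
  induction l generalizing x with
  | nil => simp [pathWeight]
  | cons z l ih => simp [pathWeight, ← ih]

lemma prod_crossings_cons (P : Matrix V V ℝ) (x : V) (l : List V) :
    ((crossings ((x :: l : List V) : Cycle V)).map fun e => P e.1 e.2).prod =
      pathWeight P x l x := by
  rw [← prod_zip_eq_pathWeight]
  have : crossings ((x :: l : List V) : Cycle V) =
      (List.zip (x :: l) (l ++ [x]) : Multiset (V × V)) := by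
    have h : (x :: l).rotate 1 = l ++ [x] := by simp
    rw [← h]; rfl
  rw [this]
  simp

lemma isChain_of_pathWeight_ne_zero {P : Matrix V V ℝ} {l : List V} {x y : V}
    (h : pathWeight P x l y ≠ 0) : List.IsChain (GraphAdj P) (x :: (l ++ [y])) := by
  induction l generalizing x with
  | nil => exact (List.isChain_pair).2 (Or.inl h)
  | cons z l ih =>
    rw [List.cons_append, List.isChain_cons_cons]
    exact ⟨Or.inl (left_ne_zero_of_mul h), ih (right_ne_zero_of_mul h)⟩

variable [Fintype V]

lemma tsum_list (f : List V → ℝ≥0∞) :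
    ∑' l, f l = f [] + ∑ z, ∑' l, f (z :: l) := by
  classical
  rw [ENNReal.tsum_eq_add_tsum_ite []]
  congr 1
  have hinj : Function.Injective fun p : V × List V => p.1 :: p.2 := by
    rintro ⟨a, l⟩ ⟨b, m⟩ h
    simpa using h
  rw [← hinj.tsum_eq]
  · simp only [reduceCtorEq, if_false]
    rw [ENNReal.tsum_prod (f := fun z l => f (z :: l)), tsum_fintype]
  · intro l hl
    cases l with
    | nil => simp at hl
    | cons z l => exact ⟨(z, l), rfl⟩

lemma matrix_pow_nonneg [DecidableEq V] {P : Matrix V V ℝ} (hP : ∀ x y, 0 ≤ P x y) (n : ℕ) :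
    ∀ x y, 0 ≤ (P ^ n) x y := by
  induction n with
  | zero => intro x y; by_cases h : x = y <;> simp [h]
  | succ n ih =>
    intro x y
    rw [pow_succ, Matrix.mul_apply]
    exact Finset.sum_nonneg fun z _ => mul_nonneg (ih x z) (hP z y)

/-- The list contains only the intermediate vertices, so `n` of them make `n + 1` steps. -/
lemma tsum_pathWeight_length [DecidableEq V] {P : Matrix V V ℝ} (hP : ∀ x y, 0 ≤ P x y) (n : ℕ)
    (x y : V) :
    ∑' l : List V, (if l.length = n then ENNReal.ofReal (pathWeight P x l y) else 0) =
      ENNReal.ofReal ((P ^ (n + 1)) x y) := by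
  induction n generalizing x with
  | zero =>
    rw [tsum_list]
    simp [pathWeight]
  | succ n ih =>
    rw [tsum_list, pow_succ', Matrix.mul_apply,
      ENNReal.ofReal_sum_of_nonneg fun z _ => mul_nonneg (hP x z) (matrix_pow_nonneg hP _ _ _)]
    simp only [List.length_nil, List.length_cons, Nat.add_right_cancel_iff, pathWeight]
    rw [if_neg (by omega), zero_add]
    refine Finset.sum_congr rfl fun z _ => ?_
    rw [ENNReal.ofReal_mul (hP x z), ← ih, ← ENNReal.tsum_mul_left]
    refine tsum_congr fun l => ?_
    split_ifs
    · rw [ENNReal.ofReal_mul (hP x z)]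
    · simp

/-- Used with `φ = 1` for the mean occupation and with `φ n = 1 / (n + 1)` for the total loop mass.
-/
lemma tsum_pathWeight_mul [DecidableEq V] {P : Matrix V V ℝ} (hP : ∀ x y, 0 ≤ P x y)
    (φ : ℕ → ℝ≥0∞) (x y : V) :
    ∑' l : List V, ENNReal.ofReal (pathWeight P x l y) * φ l.length =
      ∑' n : ℕ, ENNReal.ofReal ((P ^ (n + 1)) x y) * φ n := by
  have h : ∀ l : List V, ENNReal.ofReal (pathWeight P x l y) * φ l.length =
      ∑' n : ℕ, (if l.length = n then ENNReal.ofReal (pathWeight P x l y) else 0) * φ n := by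
    intro l
    rw [tsum_eq_single l.length fun n hn => by rw [if_neg hn.symm, zero_mul], if_pos rfl]
  simp_rw [h]
  rw [ENNReal.tsum_comm]
  simp_rw [ENNReal.tsum_mul_right, tsum_pathWeight_length hP]

end PathWeight

/-! ### From unrooted loops to paths based at a vertex. -/

section LoopMass

variable {V : Type*} {P : Matrix V V ℝ}

lemma multiplicity_mk {l : List V} (hl : l ≠ []) (h) :
    UnrootedLoop.multiplicity (P := P) ⟨(l : Cycle V), h⟩ = l.length / rotPeriod l :=
  sSup_flatten_replicate_eq hl

lemma length_pos (γ : UnrootedLoop P) : 0 < γ.1.length := by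
  rw [← Cycle.card_toMultiset, Multiset.card_pos, Ne, Cycle.toMultiset_eq_nil]
  exact γ.2.1

variable [DecidableEq V]

/-- A loop has `γ.visits x / γ.multiplicity` different roots at `x`. -/
lemma mass_mul_visits (γ : UnrootedLoop P) (x : V) :
    ENNReal.ofReal γ.mass * (γ.visits x : ℝ≥0∞) =
      ∑' l : List V, if ((x :: l : List V) : Cycle V) = γ.1 then
        ENNReal.ofReal (pathWeight P x l x) else 0 := by
  obtain ⟨c, hc⟩ := γ
  induction c using Quotient.inductionOn' with | h l₀ => ?_
  change (l₀ : Cycle V) ≠ Cycle.nil ∧ (l₀ : Cycle V).Chain (GraphAdj P) at hc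
  have hl₀ : l₀ ≠ [] := fun h => hc.1 (by rw [h]; rfl)
  set W : ℝ := ((crossings (l₀ : Cycle V)).map fun e => P e.1 e.2).prod with hW
  have hJ : 0 < l₀.length / rotPeriod l₀ :=
    Nat.div_pos (Nat.le_of_dvd (List.length_pos_of_ne_nil hl₀) (rotPeriod_dvd_length l₀))
      (rotPeriod_pos hl₀)
  have h1 : UnrootedLoop.mass (P := P) ⟨(l₀ : Cycle V), hc⟩ =
      W / ((l₀.length / rotPeriod l₀ : ℕ) : ℝ) := by
    rw [← multiplicity_mk hl₀ hc]; rfl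
  have h2 : UnrootedLoop.visits (P := P) ⟨(l₀ : Cycle V), hc⟩ x = l₀.count x := by
    simp [UnrootedLoop.visits]
  -- All rootings of the loop have the same weight `W`, so only their number matters.
  have h3 : ∀ l : List V, (if ((x :: l : List V) : Cycle V) = (l₀ : Cycle V) then
      ENNReal.ofReal (pathWeight P x l x) else 0) =
      if l ∈ rootedTails x l₀ then ENNReal.ofReal W else 0 := by
    intro l
    simp only [mem_rootedTails]
    split_ifs with h
    · rw [← prod_crossings_cons, h]
    · rfl
  change ENNReal.ofReal (UnrootedLoop.mass (P := P) ⟨(l₀ : Cycle V), hc⟩) *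
    (UnrootedLoop.visits (P := P) ⟨(l₀ : Cycle V), hc⟩ x : ℝ≥0∞) =
    ∑' l : List V, if ((x :: l : List V) : Cycle V) = (l₀ : Cycle V) then
        ENNReal.ofReal (pathWeight P x l x) else 0
  simp_rw [h3]
  rw [tsum_eq_sum (s := rootedTails x l₀) fun l hl => if_neg hl,
    Finset.sum_congr rfl fun l hl => if_pos hl, Finset.sum_const, h1, h2,
    ← card_rootedTails_mul x hl₀, ENNReal.ofReal_div_of_pos (by exact_mod_cast hJ),
    ENNReal.ofReal_natCast, nsmul_eq_mul, Nat.cast_mul, mul_comm, mul_assoc,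
    ENNReal.mul_div_cancel (by exact_mod_cast hJ.ne') (ENNReal.natCast_ne_top _)]

/-- Summation over unrooted loops by choosing a root at `x`. -/
lemma tsum_mass_mul_visits (F : Cycle V → ℝ≥0∞) (x : V) :
    ∑' γ : UnrootedLoop P, ENNReal.ofReal γ.mass * (γ.visits x : ℝ≥0∞) * F γ.1 =
      ∑' l : List V, ENNReal.ofReal (pathWeight P x l x) * F ((x :: l : List V) : Cycle V) := by
  simp_rw [mass_mul_visits, ← ENNReal.tsum_mul_right]
  rw [ENNReal.tsum_comm]
  refine tsum_congr fun l => ?_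
  -- Closed paths of nonzero weight are loops of the graph, and the others contribute nothing; hence
  -- the sum may run over all lists.
  by_cases h : pathWeight P x l x = 0
  · simp [h]
  · have hc : ((x :: l : List V) : Cycle V) ≠ Cycle.nil ∧
        ((x :: l : List V) : Cycle V).Chain (GraphAdj P) :=
      ⟨by simp [Cycle.coe_eq_nil], isChain_of_pathWeight_ne_zero h⟩
    refine (tsum_eq_single (L := .unconditional (UnrootedLoop P)) (⟨_, hc⟩ : UnrootedLoop P)
      fun γ hγ => ?_).trans (by rw [if_pos rfl])
    rw [if_neg fun h => hγ (Subtype.ext h.symm), zero_mul]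

lemma sum_visits [Fintype V] (γ : UnrootedLoop P) : ∑ x, γ.visits x = γ.1.length := by
  rw [← Cycle.card_toMultiset]
  exact Multiset.sum_count_eq_card fun a _ => Finset.mem_univ a

/-- The total mass of the loop measure is `∑ tr (P ^ n) / n`. -/
lemma tsum_mass [Fintype V] (hP : ∀ x y, 0 ≤ P x y) :
    ∑' γ : UnrootedLoop P, ENNReal.ofReal γ.mass =
      ∑ x, ∑' n : ℕ, ENNReal.ofReal ((P ^ (n + 1)) x x) * ((n + 1 : ℕ) : ℝ≥0∞)⁻¹ := by
  -- Spread the mass of each loop over the vertices in proportion to its visits, which add up to its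
  -- length.
  have h : ∀ γ : UnrootedLoop P, ENNReal.ofReal γ.mass =
      ∑ x, ENNReal.ofReal γ.mass * (γ.visits x : ℝ≥0∞) * (γ.1.length : ℝ≥0∞)⁻¹ := by
    intro γ
    have := length_pos γ
    rw [← Finset.sum_mul, ← Finset.mul_sum, ← Nat.cast_sum, sum_visits, mul_assoc,
      ENNReal.mul_inv_cancel (by exact_mod_cast this.ne') (ENNReal.natCast_ne_top _), mul_one]
  rw [tsum_congr h, Summable.tsum_finsetSum fun _ _ => ENNReal.summable]
  refine Finset.sum_congr rfl fun x _ => ?_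
  rw [tsum_mass_mul_visits (fun c => (c.length : ℝ≥0∞)⁻¹), ← tsum_pathWeight_mul hP
    (fun n => ((n + 1 : ℕ) : ℝ≥0∞)⁻¹)]
  simp

end LoopMass

/-! ### The Poisson distribution. -/

section Poisson

lemma isProbabilityMeasure_poissonLaw (r : ℝ≥0∞) : IsProbabilityMeasure (poissonLaw r) := by
  unfold poissonLaw
  split_ifs
  · infer_instance
  · exact Measure.isProbabilityMeasure_map (by fun_prop)

lemma lintegral_poissonLaw {r : ℝ≥0∞} (hr : r ≠ ∞) {F : ℝ≥0∞ → ℝ≥0∞} (hF : Measurable F) :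
    ∫⁻ t, F t ∂poissonLaw r = ∑' n : ℕ, F n * poissonMeasure r.toNNReal {n} := by
  rw [poissonLaw, if_neg hr, lintegral_map hF (by fun_prop), lintegral_countable']

lemma poissonMeasure_singleton_succ (r : NNReal) (n : ℕ) :
    ((n + 1 : ℕ) : ℝ≥0∞) * poissonMeasure r {n + 1} = r * poissonMeasure r {n} := by
  rw [poissonMeasure_singleton, poissonMeasure_singleton, ← ENNReal.ofReal_natCast,
    ← ENNReal.ofReal_coe_nnreal, ← ENNReal.ofReal_mul (by positivity),
    ← ENNReal.ofReal_mul (by positivity), Nat.factorial_succ]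
  congr 1
  push_cast
  have : ((n : ℝ) + 1) ≠ 0 := by positivity
  have : (Nat.factorial n : ℝ) ≠ 0 := by positivity
  field_simp
  ring

/-- The Chen–Stein identity for the Poisson distribution. -/
lemma lintegral_mul_poissonLaw {r : ℝ≥0∞} (hr : r ≠ ∞) {F : ℝ≥0∞ → ℝ≥0∞} (hF : Measurable F) :
    ∫⁻ t, t * F t ∂poissonLaw r = r * ∫⁻ t, F (t + 1) ∂poissonLaw r := by
  have h₁ : Measurable fun t => t * F t := measurable_id.mul hF
  have h₂ : Measurable fun t => F (t + 1) := hF.comp (measurable_id.add_const 1)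
  rw [lintegral_poissonLaw hr h₁, lintegral_poissonLaw hr h₂, ← ENNReal.tsum_mul_left,
    tsum_eq_zero_add' ENNReal.summable]
  simp only [Nat.cast_zero, zero_mul, zero_add]
  refine tsum_congr fun n => ?_
  have := poissonMeasure_singleton_succ r.toNNReal n
  rw [ENNReal.coe_toNNReal hr] at this
  rw [mul_right_comm, this, Nat.cast_add_one]
  ring

lemma ae_poissonLaw_exists_nat {r : ℝ≥0∞} (hr : r ≠ ∞) :
    ∀ᵐ t : ℝ≥0∞ ∂poissonLaw r, ∃ n : ℕ, t = (n : ℝ≥0∞) := by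
  rw [poissonLaw, if_neg hr, ae_map_iff (by fun_prop)]
  · exact Filter.Eventually.of_forall fun n => ⟨n, rfl⟩
  · have : {t : ℝ≥0∞ | ∃ n : ℕ, t = (n : ℝ≥0∞)} = Set.range (fun n : ℕ => (n : ℝ≥0∞)) := by
      ext t; simp [eq_comm]
    rw [this]
    exact (Set.countable_range _).measurableSet

lemma poissonLaw_singleton_zero {r : ℝ≥0∞} (hr : r ≠ ∞) :
    poissonLaw r {0} = ENNReal.ofReal (Real.exp (-r.toReal)) := by
  rw [poissonLaw, if_neg hr, Measure.map_apply (by fun_prop) (measurableSet_singleton 0)]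
  have : (fun n : ℕ => (n : ℝ≥0∞)) ⁻¹' {0} = {0} := by ext n; simp
  rw [this, poissonMeasure_singleton]
  simp [ENNReal.toReal]

lemma exists_nat_eq_tsum {ι : Type*} {f : ι → ℝ≥0∞} (hf : ∀ i, ∃ n : ℕ, f i = n)
    (h : ∑' i, f i ≠ ∞) : ∃ n : ℕ, ∑' i, f i = n := by
  choose k hk using hf
  have hfin := ENNReal.finite_const_le_of_tsum_ne_top h one_ne_zero
  refine ⟨∑ i ∈ hfin.toFinset, k i, ?_⟩
  rw [tsum_eq_sum (s := hfin.toFinset), Nat.cast_sum]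
  · exact Finset.sum_congr rfl fun i _ => hk i
  · intro i hi
    rw [Set.Finite.mem_toFinset, Set.mem_ofPred_eq, hk, not_le] at hi
    have : k i < 1 := by exact_mod_cast hi
    rw [hk, Nat.lt_one_iff.1 this, Nat.cast_zero]

end Poisson

/-! ### The Mecke equation on a countable space. -/

section PoissonPointProcess

variable {Ω E : Type*} [MeasurableSpace Ω] [MeasurableSpace E]
  {Pr : Measure Ω} {ν : Measure E} {N : Ω → Measure E}

variable {V : Type*} (f : E → V → ℕ)

/-- The total mark of the points of the configuration. -/
noncomputable def markSum (N : Ω → Measure E) (x : V) (ω : Ω) : ℝ≥0∞ :=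
  ∑' e, (f e x : ℝ≥0∞) * N ω {e}

variable {f}

/-- Every point has a nonzero mark, so all mark sums vanish exactly when there are no points. -/
lemma IsPoissonPointProcess.prob_markSum_eq_zero [Countable E]
    (hN : IsPoissonPointProcess Pr ν N) (hν : ν Set.univ ≠ ∞) (hf : ∀ e, ∃ x, f e x ≠ 0) :
    Pr {ω | ∀ x, markSum f N x ω = 0} = ENNReal.ofReal (Real.exp (-(ν Set.univ).toReal)) := by
  have hm : Measurable fun ω => N ω Set.univ :=
    (Measure.measurable_coe MeasurableSet.univ).comp hN.measurable
  rw [← poissonLaw_singleton_zero hν, ← hN.law _ MeasurableSet.univ,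
    Measure.map_apply hm (measurableSet_singleton 0)]
  congr 1
  ext ω
  simp only [Set.mem_ofPred_eq, Set.mem_preimage, Set.mem_singleton_iff]
  constructor
  · intro h
    rw [← Set.iUnion_of_singleton, measure_iUnion_null_iff]
    intro e
    obtain ⟨x, hx⟩ := hf e
    have := ENNReal.tsum_eq_zero.1 (h x) e
    simpa [hx] using this
  · intro h x
    refine ENNReal.tsum_eq_zero.2 fun e => ?_
    rw [measure_mono_null (Set.subset_univ _) h, mul_zero]

variable [MeasurableSingletonClass E]

lemma IsPoissonPointProcess.measurable_singleton (hN : IsPoissonPointProcess Pr ν N) (e : E) :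
    Measurable fun ω => N ω {e} :=
  (Measure.measurable_coe (measurableSet_singleton e)).comp hN.measurable

lemma IsPoissonPointProcess.iIndepFun_singleton (hN : IsPoissonPointProcess Pr ν N) :
    iIndepFun (fun (e : E) ω => N ω {e}) Pr := by
  rw [iIndepFun_iff_finset]
  intro S
  have h := hN.indep S.card (fun i => {(S.equivFin.symm i : E)})
    (fun i => measurableSet_singleton _) (fun i j hij => by
      refine Set.disjoint_singleton.2 ?_
      exact fun h => hij (S.equivFin.symm.injective (Subtype.ext h)))
  have h' := h.precomp S.equivFin.injective
  simp only [Equiv.symm_apply_apply] at h'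
  exact h'

lemma IsPoissonPointProcess.measurable_markSum [Countable E] (hN : IsPoissonPointProcess Pr ν N)
    (x : V) : Measurable (markSum f N x) :=
  Measurable.tsum fun e => (hN.measurable_singleton e).const_mul _

open Classical in
lemma IsPoissonPointProcess.indepFun_tsum_ne [Countable E] (hN : IsPoissonPointProcess Pr ν N)
    (e : E) :
    IndepFun (fun ω => N ω {e})
      (fun ω (x : V) => ∑' e', if e' = e then 0 else (f e' x : ℝ≥0∞) * N ω {e'}) Pr := by
  have h := indep_iSup_of_disjoint (fun e => (hN.measurable_singleton e).comap_le)
    ((iIndepFun_iff_iIndep _ _ _).1 hN.iIndepFun_singleton) (S := {e}) (T := {e}ᶜ)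
    disjoint_compl_right
  rw [IndepFun_iff_Indep]
  refine indep_of_indep_of_le_left (indep_of_indep_of_le_right h ?_) ?_
  · rw [← measurable_iff_comap_le]
    refine @measurable_pi_lambda _ _ _ (_) _ _ fun x =>
      @Measurable.tsum _ _ _ (_) _ _ _ _ _ _ _ _ _ _ _ _ fun e' => ?_
    by_cases he : e' = e
    · simp only [he, if_true]
      exact measurable_const
    · simp only [he, if_false]
      refine Measurable.const_mul ?_ _
      rw [measurable_iff_comap_le]
      exact le_iSup₂_of_le (f := fun i (_ : i ∈ ({e}ᶜ : Set E)) =>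
        MeasurableSpace.comap (fun ω => N ω {i}) inferInstance) e' he le_rfl
  · exact le_iSup₂_of_le (f := fun i (_ : i ∈ ({e} : Set E)) =>
      MeasurableSpace.comap (fun ω => N ω {i}) inferInstance) e (Set.mem_singleton e) le_rfl

/-- The Mecke equation for the points located at `e`. -/
lemma IsPoissonPointProcess.lintegral_indicator_markSum [Countable E] [Finite V]
    [IsProbabilityMeasure Pr] (hN : IsPoissonPointProcess Pr ν N) (e : E) (he : ν {e} ≠ ∞)
    (q : V → ℝ≥0∞) :
    ∫⁻ ω, N ω {e} * Set.indicator {ω | ∀ x, markSum f N x ω = q x} 1 ω ∂Pr =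
      ν {e} * Pr {ω | ∀ x, markSum f N x ω + f e x = q x} := by
  classical
  have : Fintype V := Fintype.ofFinite V
  set T : Ω → V → ℝ≥0∞ := fun ω x => ∑' e', if e' = e then 0 else (f e' x : ℝ≥0∞) * N ω {e'}
    with hT
  have hTm : Measurable T := by
    refine measurable_pi_lambda _ fun x => Measurable.tsum fun e' => ?_
    split_ifs
    · exact measurable_const
    · exact (hN.measurable_singleton e').const_mul _
  have hdec : ∀ x ω, markSum f N x ω = f e x * N ω {e} + T ω x := fun x ω =>
    ENNReal.tsum_eq_add_tsum_ite e
  set D : Set ((V → ℝ≥0∞) × ℝ≥0∞) := {p | ∀ x, f e x * p.2 + p.1 x = q x} with hD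
  have hDm : MeasurableSet D := by
    rw [hD, Set.ofPred_forall]
    refine MeasurableSet.iInter fun x => measurableSet_eq_fun ?_ measurable_const
    fun_prop
  -- `D'` is `D` with one more point at `e`. By independence, Chen–Stein applies to the second
  -- coordinate with the contribution `T` of the other points frozen, and replaces `D` by `D'`.
  set D' : Set ((V → ℝ≥0∞) × ℝ≥0∞) := {p | ∀ x, f e x * (p.2 + 1) + p.1 x = q x} with hD'
  have hDm' : MeasurableSet D' := by
    rw [hD', Set.ofPred_forall]
    refine MeasurableSet.iInter fun x => measurableSet_eq_fun ?_ measurable_const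
    fun_prop
  have hNm := hN.measurable_singleton e
  have hmap : Pr.map (fun ω => (T ω, N ω {e})) = (Pr.map T).prod (poissonLaw (ν {e})) := by
    rw [← hN.law _ (measurableSet_singleton e)]
    exact (indepFun_iff_map_prod_eq_prod_map_map hTm.aemeasurable hNm.aemeasurable).1
      (hN.indepFun_tsum_ne e).symm
  have := isProbabilityMeasure_poissonLaw (ν {e})
  have hind : ∀ t : V → ℝ≥0∞, Measurable fun s : ℝ≥0∞ => D.indicator (1 : (V → ℝ≥0∞) × ℝ≥0∞ → ℝ≥0∞) (t, s) :=
    fun t => (measurable_one.indicator hDm).comp measurable_prodMk_left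
  have hmul : Measurable fun p : (V → ℝ≥0∞) × ℝ≥0∞ => p.2 * D.indicator 1 p :=
    measurable_snd.mul (measurable_one.indicator hDm)
  calc ∫⁻ ω, N ω {e} * Set.indicator {ω | ∀ x, markSum f N x ω = q x} 1 ω ∂Pr
      = ∫⁻ p, p.2 * D.indicator 1 p ∂(Pr.map fun ω => (T ω, N ω {e})) := by
        rw [lintegral_map hmul (hTm.prodMk hNm)]
        refine lintegral_congr fun ω => ?_
        simp only [hdec, Set.indicator, Set.mem_ofPred_eq, hD]
        rfl
    _ = ∫⁻ t, ∫⁻ s, s * D.indicator 1 (t, s) ∂poissonLaw (ν {e}) ∂(Pr.map T) := by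
        rw [hmap, lintegral_prod]
        exact hmul.aemeasurable
    _ = ν {e} * ∫⁻ t, ∫⁻ s, D'.indicator 1 (t, s) ∂poissonLaw (ν {e}) ∂(Pr.map T) := by
        rw [← lintegral_const_mul]
        · refine lintegral_congr fun t => ?_
          rw [lintegral_mul_poissonLaw he (hind t)]
          rfl
        · exact (measurable_one.indicator hDm').lintegral_prod_right'
    _ = ν {e} * ∫⁻ p, D'.indicator 1 p ∂(Pr.map fun ω => (T ω, N ω {e})) := by
        rw [hmap, lintegral_prod]
        exact (measurable_one.indicator hDm').aemeasurable
    _ = ν {e} * Pr {ω | ∀ x, markSum f N x ω + f e x = q x} := by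
        rw [lintegral_indicator_one hDm', Measure.map_apply (hTm.prodMk hNm) hDm']
        congr 2
        ext ω
        simp only [hD', Set.mem_preimage, Set.mem_ofPred_eq, hdec, mul_add, mul_one]
        refine forall_congr' fun x => ?_
        rw [add_right_comm]

lemma IsPoissonPointProcess.lintegral_singleton (hN : IsPoissonPointProcess Pr ν N) (e : E)
    (he : ν {e} ≠ ∞) : ∫⁻ ω, N ω {e} ∂Pr = ν {e} := by
  have := isProbabilityMeasure_poissonLaw (ν {e})
  have h := lintegral_mul_poissonLaw he (F := fun _ => 1) measurable_const
  rw [← hN.law _ (measurableSet_singleton e), lintegral_map (by fun_prop)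
    (hN.measurable_singleton e), hN.law _ (measurableSet_singleton e)] at h
  simpa using h

/-- The mark sums have finite mean, hence are almost surely finite, and a finite sum of natural
numbers in `[0, ∞]` is a natural number. -/
lemma IsPoissonPointProcess.ae_exists_nat_markSum [Countable E] [Countable V]
    (hN : IsPoissonPointProcess Pr ν N) (hν : ∀ e, ν {e} ≠ ∞)
    (hf : ∀ x, ∑' e, (f e x : ℝ≥0∞) * ν {e} ≠ ∞) :
    ∀ᵐ ω ∂Pr, ∃ q : V → ℕ, ∀ x, markSum f N x ω = q x := by
  have h1 : ∀ᵐ ω ∂Pr, ∀ e, ∃ n : ℕ, N ω {e} = (n : ℝ≥0∞) := by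
    rw [ae_all_iff]
    intro e
    have := ae_poissonLaw_exists_nat (hν e)
    rw [← hN.law _ (measurableSet_singleton e)] at this
    exact ae_of_ae_map (hN.measurable_singleton e).aemeasurable this
  have h2 : ∀ᵐ ω ∂Pr, ∀ x, markSum f N x ω ≠ ∞ := by
    rw [ae_all_iff]
    intro x
    have h : ∫⁻ ω, markSum f N x ω ∂Pr ≠ ∞ := by
      unfold markSum
      rw [lintegral_tsum fun e => ((hN.measurable_singleton e).const_mul _).aemeasurable]
      simp_rw [lintegral_const_mul _ (hN.measurable_singleton _),
        hN.lintegral_singleton _ (hν _)]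
      exact hf x
    filter_upwards [ae_lt_top (hN.measurable_markSum x) h] with ω hω using hω.ne
  filter_upwards [h1, h2] with ω hω1 hω2
  have : ∀ x, ∃ n : ℕ, markSum f N x ω = n := fun x =>
    exists_nat_eq_tsum (fun e => by
      obtain ⟨n, hn⟩ := hω1 e
      exact ⟨f e x * n, by rw [hn, Nat.cast_mul]⟩) (hω2 x)
  choose q hq using this
  exact ⟨q, hq⟩

/-- On the event, `q x` is the mark sum itself; expand it over the points and apply the Mecke
equation to each term. -/
lemma IsPoissonPointProcess.markSum_recursion [Countable E] [Finite V] [IsProbabilityMeasure Pr]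
    (hN : IsPoissonPointProcess Pr ν N) (hν : ∀ e, ν {e} ≠ ∞) (q : V → ℝ≥0∞) (x : V) :
    q x * Pr {ω | ∀ y, markSum f N y ω = q y} =
      ∑' e, f e x * ν {e} * Pr {ω | ∀ y, markSum f N y ω + f e y = q y} := by
  have hm : MeasurableSet {ω | ∀ y, markSum f N y ω = q y} := by
    rw [Set.ofPred_forall]
    exact MeasurableSet.iInter fun y =>
      measurableSet_eq_fun (hN.measurable_markSum y) measurable_const
  have hmi : Measurable (Set.indicator {ω | ∀ y, markSum f N y ω = q y} (1 : Ω → ℝ≥0∞)) :=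
    measurable_one.indicator hm
  calc q x * Pr {ω | ∀ y, markSum f N y ω = q y}
      = ∫⁻ ω, markSum f N x ω * Set.indicator {ω | ∀ y, markSum f N y ω = q y} 1 ω ∂Pr := by
        rw [← lintegral_indicator_one hm, ← lintegral_const_mul _ hmi]
        refine lintegral_congr fun ω => ?_
        by_cases h : ω ∈ {ω | ∀ y, markSum f N y ω = q y}
        · rw [h x]
        · simp [Set.indicator_of_notMem h]
    _ = ∑' e, f e x * ∫⁻ ω, N ω {e} *
          Set.indicator {ω | ∀ y, markSum f N y ω = q y} 1 ω ∂Pr := by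
        have : ∀ ω, markSum f N x ω * Set.indicator {ω | ∀ y, markSum f N y ω = q y} 1 ω =
            ∑' e, f e x * (N ω {e} * Set.indicator {ω | ∀ y, markSum f N y ω = q y} 1 ω) := by
          intro ω
          simp_rw [← mul_assoc]
          rw [ENNReal.tsum_mul_right]; rfl
        simp_rw [this]
        have hmul : ∀ e, Measurable fun ω => N ω {e} *
            Set.indicator {ω | ∀ y, markSum f N y ω = q y} 1 ω :=
          fun e => (hN.measurable_singleton e).mul hmi
        rw [lintegral_tsum fun e => ((hmul e).const_mul _).aemeasurable]
        exact tsum_congr fun e => lintegral_const_mul _ (hmul e)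
    _ = _ := by
        refine tsum_congr fun e => ?_
        rw [hN.lintegral_indicator_markSum e (hν e), mul_assoc]

end PoissonPointProcess

/-! ### The determinant of `1 - P` as the exponential of a trace series. -/

section LogDet

variable {V : Type*} [Fintype V] [DecidableEq V]

/-- The resolvent series `∑ tⁿ Pⁿ`. -/
noncomputable def resolvent (P : Matrix V V ℝ) (t : ℝ) : Matrix V V ℝ :=
  Matrix.of fun x y => ∑' n : ℕ, t ^ n * (P ^ n) x y

lemma summable_pow_mul {a : ℕ → ℝ} (ha : ∀ n, 0 ≤ a n) (hs : Summable a) {t : ℝ} (ht : |t| ≤ 1) :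
    Summable fun n => t ^ n * a n := by
  refine Summable.of_norm_bounded hs fun n => ?_
  rw [Real.norm_eq_abs, abs_mul, abs_pow, abs_of_nonneg (ha n)]
  exact mul_le_of_le_one_left (ha n) (pow_le_one₀ (abs_nonneg t) ht)

variable {P : Matrix V V ℝ}

lemma one_sub_smul_mul_resolvent (hP : ∀ x y, 0 ≤ P x y)
    (hs : ∀ x y, Summable fun n : ℕ => (P ^ n) x y) {t : ℝ} (ht : |t| ≤ 1) :
    (1 - t • P) * resolvent P t = 1 := by
  have hsum : ∀ x y, Summable fun n : ℕ => t ^ n * (P ^ n) x y := fun x y =>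
    summable_pow_mul (fun n => matrix_pow_nonneg hP n x y) (hs x y) ht
  rw [sub_mul, one_mul, sub_eq_iff_eq_add]
  ext x y
  simp only [resolvent, Matrix.of_apply, Matrix.add_apply, Matrix.mul_apply, Matrix.smul_apply,
    smul_eq_mul]
  rw [(hsum x y).tsum_eq_zero_add]
  congr 1
  · simp
  · simp_rw [← tsum_mul_left]
    rw [← Summable.tsum_finsetSum fun z _ => (hsum z y).mul_left _]
    refine tsum_congr fun n => ?_
    rw [pow_succ' P, Matrix.mul_apply, Finset.mul_sum]
    refine Finset.sum_congr rfl fun z _ => ?_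
    ring

lemma trace_resolvent_mul (hP : ∀ x y, 0 ≤ P x y)
    (hs : ∀ x y, Summable fun n : ℕ => (P ^ n) x y) {t : ℝ} (ht : |t| ≤ 1) :
    (resolvent P t * P).trace = ∑' n : ℕ, t ^ n * (P ^ (n + 1)).trace := by
  have hsum : ∀ x y, Summable fun n : ℕ => t ^ n * (P ^ n) x y := fun x y =>
    summable_pow_mul (fun n => matrix_pow_nonneg hP n x y) (hs x y) ht
  simp only [Matrix.trace, Matrix.diag, Matrix.mul_apply, resolvent, Matrix.of_apply, pow_succ P,
    ← tsum_mul_right]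
  have h : ∀ x z, Summable fun n : ℕ => t ^ n * (P ^ n) x z * P z x := fun x z =>
    (hsum x z).mul_right _
  simp_rw [← Summable.tsum_finsetSum fun z _ => h _ z]
  rw [← Summable.tsum_finsetSum fun x _ => summable_sum fun z _ => h x z]
  refine tsum_congr fun n => ?_
  rw [Finset.mul_sum]
  refine Finset.sum_congr rfl fun x _ => ?_
  rw [Finset.mul_sum]
  exact Finset.sum_congr rfl fun z _ => by ring

/-- Jacobi's formula for `det (1 - t P)`. -/
lemma hasDerivAt_det_one_sub_smul {R : Matrix V V ℝ} {t : ℝ} (hR : (1 - t • P) * R = 1) :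
    HasDerivAt (fun s : ℝ => (1 - s • P).det) (-((1 - t • P).det * (R * P).trace)) t := by
  -- Factor `1 - s P = (1 - t P) (1 - (s - t) R P)`; `Q` is the polynomial remainder of the second
  -- determinant beyond first order in `s - t`.
  set Q := (Matrix.det (1 + (Polynomial.X : Polynomial ℝ) •
    (-(R * P)).map Polynomial.C)).divX.divX with hQ
  have h : (fun s : ℝ => (1 - s • P).det) = fun s => (1 - t • P).det *
      (1 + (-(R * P)).trace * (s - t) + Q.eval (s - t) * (s - t) ^ 2) := by
    funext s
    rw [hQ, ← Matrix.det_one_add_smul, ← Matrix.det_mul]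
    congr 1
    rw [mul_add, mul_one, mul_smul_comm, mul_neg, ← mul_assoc, hR, one_mul, smul_neg, sub_smul]
    abel
  rw [h]
  have hid : HasDerivAt (fun s : ℝ => s - t) 1 t := (hasDerivAt_id t).sub_const t
  have hQd : HasDerivAt (fun s : ℝ => Q.eval (s - t)) (Q.derivative.eval (t - t) * 1) t :=
    HasDerivAt.comp (h₂ := fun u : ℝ => Q.eval u) t (Q.hasDerivAt (t - t)) hid
  have := (((hid.const_mul (-(R * P)).trace).const_add 1).add
    (hQd.mul (hid.pow 2))).const_mul (1 - t • P).det
  refine this.congr_deriv ?_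
  simp [Matrix.trace_neg]

/-- By Jacobi's formula, `det (1 - t P) * exp (L t)` has zero derivative on `[0, 1)`. Termwise
differentiation of `L` is done only on the open interval, so `t = 1` is reached by continuity, with
`∑ tr (P ^ (n + 1))` as the dominating series. -/
lemma det_one_sub_eq_exp (hP : ∀ x y, 0 ≤ P x y)
    (hs : ∀ x y, Summable fun n : ℕ => (P ^ n) x y) :
    (1 - P).det = Real.exp (-∑' n : ℕ, (P ^ (n + 1)).trace / (n + 1)) := by
  set c : ℕ → ℝ := fun n => (P ^ (n + 1)).trace with hc
  have hc0 : ∀ n, 0 ≤ c n := fun n =>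
    Finset.sum_nonneg fun x _ => matrix_pow_nonneg hP (n + 1) x x
  have hcs : Summable c :=
    summable_sum fun x _ => (summable_nat_add_iff (f := fun n => (P ^ n) x x) 1).2 (hs x x)
  set L : ℝ → ℝ := fun t => ∑' n : ℕ, t ^ (n + 1) * (c n / (n + 1)) with hL
  have hbound : ∀ n : ℕ, 0 ≤ c n / (n + 1) ∧ c n / (n + 1) ≤ c n := fun n =>
    ⟨div_nonneg (hc0 n) (by positivity), div_le_self (hc0 n) (by
      have : (0 : ℝ) ≤ n := Nat.cast_nonneg n
      linarith)⟩
  have hLcont : ContinuousOn L (Set.Icc 0 1) := by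
    refine continuousOn_tsum (u := c) (fun n => by fun_prop) hcs fun n t ht => ?_
    rw [Real.norm_eq_abs, abs_mul, abs_pow, abs_of_nonneg ht.1, abs_of_nonneg (hbound n).1]
    exact (mul_le_of_le_one_left (hbound n).1 (pow_le_one₀ ht.1 ht.2)).trans (hbound n).2
  have hLder : ∀ t ∈ Set.Ioo (-1 : ℝ) 1, HasDerivAt L (∑' n : ℕ, t ^ n * c n) t := by
    intro t ht
    refine hasDerivAt_tsum_of_isPreconnected (𝕜 := ℝ) (F := ℝ)
      (g := fun n t => t ^ (n + 1) * (c n / (n + 1))) (g' := fun n t => t ^ n * c n) (u := c) (t := Set.Ioo (-1 : ℝ) 1) (y₀ := 0) hcs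
      isOpen_Ioo isPreconnected_Ioo (fun n s _ => ?_) (fun n s hs => ?_) (by simp) ?_ ht
    · have := (hasDerivAt_pow (n + 1) s).mul_const (c n / (n + 1))
      refine this.congr_deriv ?_
      have : (n : ℝ) + 1 ≠ 0 := by positivity
      push_cast
      field_simp
    · rw [Real.norm_eq_abs, abs_mul, abs_pow, abs_of_nonneg (hc0 n)]
      exact mul_le_of_le_one_left (hc0 n)
        (pow_le_one₀ (abs_nonneg s) (abs_le.2 ⟨hs.1.le, hs.2.le⟩))
    · simp [summable_zero]
  set G : ℝ → ℝ := fun t => (1 - t • P).det * Real.exp (L t) with hG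
  have hGcont : ContinuousOn G (Set.Icc 0 1) := by
    refine ContinuousOn.mul ?_ hLcont.rexp
    exact (Continuous.matrix_det (by fun_prop)).continuousOn
  have hGder : ∀ t ∈ Set.Ico (0 : ℝ) 1, HasDerivWithinAt G 0 (Set.Ici t) t := by
    intro t ht
    have habs : |t| ≤ 1 := abs_le.2 ⟨by linarith [ht.1], ht.2.le⟩
    have h1 := hasDerivAt_det_one_sub_smul (one_sub_smul_mul_resolvent hP hs habs)
    have h2 := (hLder t ⟨by linarith [ht.1], ht.2⟩).exp
    rw [trace_resolvent_mul hP hs habs] at h1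
    refine ((h1.mul h2).congr_deriv ?_).hasDerivWithinAt
    ring
  have hconst := constant_of_has_deriv_right_zero hGcont hGder 1 (by simp)
  have h0 : G 0 = 1 := by simp [hG, hL]
  have h1 : G 1 = (1 - P).det * Real.exp (∑' n : ℕ, c n / (n + 1)) := by simp [hG, hL]
  rw [h0, h1] at hconst
  rw [Real.exp_neg]
  exact eq_inv_of_mul_eq_one_left hconst

end LogDet

/-! ### Total mass of the loop measure. -/

section TotalMass

lemma loopMeasure_univ {V : Type*} (P : Matrix V V ℝ) :
    loopMeasure P Set.univ = ∑' γ : UnrootedLoop P, ENNReal.ofReal γ.mass := by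
  rw [loopMeasure, Measure.sum_apply _ MeasurableSet.univ]
  simp

variable {V : Type*} [Fintype V] [DecidableEq V] {P : Matrix V V ℝ}

lemma IsTransient.summable (hP : ∀ x y, 0 ≤ P x y) (h : IsTransient P) (x y : V) :
    Summable fun n : ℕ => (P ^ n) x y := by
  have := ENNReal.summable_toReal (h x y).ne
  refine this.congr fun n => ?_
  exact ENNReal.toReal_ofReal (matrix_pow_nonneg hP n x y)

lemma loopMeasure_univ_eq (hP : ∀ x y, 0 ≤ P x y) (h : IsTransient P) :
    loopMeasure P Set.univ = ENNReal.ofReal (∑' n : ℕ, (P ^ (n + 1)).trace / (n + 1)) := by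
  have hs := h.summable hP
  have hb : ∀ x (n : ℕ), 0 ≤ (P ^ (n + 1)) x x / (n + 1) := fun x n =>
    div_nonneg (matrix_pow_nonneg hP _ x x) (by positivity)
  have hsx : ∀ x, Summable fun n : ℕ => (P ^ (n + 1)) x x / (n + 1) := fun x =>
    Summable.of_nonneg_of_le (hb x) (fun n => div_le_self (matrix_pow_nonneg hP _ x x) (by
      have : (0 : ℝ) ≤ n := Nat.cast_nonneg n
      linarith)) ((summable_nat_add_iff (f := fun n => (P ^ n) x x) 1).2 (hs x x))
  have htr : ∀ n : ℕ, (P ^ (n + 1)).trace / (n + 1) =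
      ∑ x, (P ^ (n + 1)) x x / (n + 1) := fun n => by
    rw [Matrix.trace, Finset.sum_div]; rfl
  rw [loopMeasure_univ, tsum_mass hP]
  simp_rw [htr]
  rw [Summable.tsum_finsetSum fun x _ => hsx x, ENNReal.ofReal_sum_of_nonneg fun x _ =>
    tsum_nonneg (hb x)]
  refine Finset.sum_congr rfl fun x _ => ?_
  rw [ENNReal.ofReal_tsum_of_nonneg (hb x) (hsx x)]
  refine tsum_congr fun n => ?_
  rw [ENNReal.ofReal_div_of_pos (by positivity), div_eq_mul_inv]
  congr 2
  rw [← Nat.cast_succ, ENNReal.ofReal_natCast]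

end TotalMass

/-! ### The law of the occupation field. -/

section Soup

lemma countable_unrootedLoop {V : Type*} [Countable V] (P : Matrix V V ℝ) :
    Countable (UnrootedLoop P) := by
  have : Countable (Cycle V) := inferInstanceAs (Countable (Quotient (List.IsRotated.setoid V)))
  exact inferInstanceAs (Countable {c : Cycle V // c ≠ Cycle.nil ∧ c.Chain (GraphAdj P)})

instance {V : Type*} (P : Matrix V V ℝ) : DiscreteMeasurableSpace (UnrootedLoop P) :=
  ⟨fun _ => trivial⟩

lemma loopMeasure_singleton {V : Type*} (P : Matrix V V ℝ) (γ : UnrootedLoop P) :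
    loopMeasure P {γ} = ENNReal.ofReal γ.mass := by
  rw [loopMeasure, Measure.sum_smul_dirac_singleton]

lemma smul_loopMeasure_singleton_ne_top {V : Type*} {P : Matrix V V ℝ} {α : ℝ}
    (γ : UnrootedLoop P) :
    (ENNReal.ofReal α • loopMeasure P) {γ} ≠ ∞ := by
  rw [Measure.smul_apply, loopMeasure_singleton, smul_eq_mul]
  exact ENNReal.mul_ne_top ENNReal.ofReal_ne_top ENNReal.ofReal_ne_top

lemma occupation_eq_markSum {Ω V : Type*} [Countable V] [DecidableEq V] {P : Matrix V V ℝ}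
    (L : Ω → Measure (UnrootedLoop P)) :
    occupation L = markSum (fun γ x => γ.visits x) L := by
  have := countable_unrootedLoop P
  funext x ω
  exact lintegral_countable' _

variable {Ω V : Type*} [MeasurableSpace Ω] [DecidableEq V] {P : Matrix V V ℝ}
  {Pr : Measure Ω} {α : ℝ} {L : Ω → Measure (UnrootedLoop P)}

/-- The probability that the occupation field plus the numbers of visits of a list is `q`. -/
noncomputable def shiftedLaw (Pr : Measure Ω) (L : Ω → Measure (UnrootedLoop P)) (q : V → ℕ)
    (m : Multiset V) : ℝ≥0∞ :=
  Pr {ω | ∀ y, occupation L y ω + (m.count y : ℝ≥0∞) = (q y : ℝ≥0∞)}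

/-- A visit at `z` uses up one unit of `q z`; if none is left, the event is empty. -/
lemma shiftedLaw_cons (q : V → ℕ) (z : V) (m : Multiset V) :
    shiftedLaw Pr L q (z ::ₘ m) =
      if 0 < q z then shiftedLaw Pr L (q - Pi.single z 1) m else 0 := by
  unfold shiftedLaw
  split_ifs with hz
  · congr 1
    ext ω
    refine forall_congr' fun y => ?_
    by_cases h : y = z
    · subst h
      have : ((q y : ℕ) : ℝ≥0∞) = ((q y - 1 : ℕ) : ℝ≥0∞) + 1 := by
        rw [← Nat.cast_add_one, Nat.sub_add_cancel hz]
      rw [Multiset.count_cons_self, this, Nat.cast_add_one, ← add_assoc,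
        ENNReal.add_left_inj ENNReal.one_ne_top]
      simp
    · rw [Multiset.count_cons_of_ne h]
      simp [h]
  · convert! measure_empty (μ := Pr)
    refine Set.eq_empty_of_forall_notMem fun ω hω => ?_
    have := hω z
    rw [Multiset.count_cons_self, Nat.eq_zero_of_not_pos hz] at this
    simp at this

variable [Fintype V]

/-- The recursion obtained from the Mecke equation by choosing a visit at `x`. -/
lemma IsLoopSoup.shiftedLaw_recursion [IsProbabilityMeasure Pr] (hL : IsLoopSoup Pr α P L)
    (q : V → ℕ) (x : V) :
    q x * shiftedLaw Pr L q 0 = ENNReal.ofReal α * ∑' l : List V,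
      ENNReal.ofReal (pathWeight P x l x) * shiftedLaw Pr L q (x ::ₘ l) := by
  have := countable_unrootedLoop P
  have h := IsPoissonPointProcess.markSum_recursion (f := fun γ x => γ.visits x) hL
    smul_loopMeasure_singleton_ne_top (fun y => (q y : ℝ≥0∞)) x
  rw [← occupation_eq_markSum] at h
  have h0 : shiftedLaw Pr L q 0 = Pr {ω | ∀ y, occupation L y ω = (q y : ℝ≥0∞)} := by
    simp [shiftedLaw]
  rw [h0, h]
  have h1 := tsum_mass_mul_visits (P := P) (fun c => shiftedLaw Pr L q c.toMultiset) x
  simp only [Cycle.coe_toMultiset, ← Multiset.cons_coe] at h1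
  rw [← h1, ← ENNReal.tsum_mul_left]
  refine tsum_congr fun γ => ?_
  rw [Measure.smul_apply, loopMeasure_singleton, smul_eq_mul]
  have h2 : shiftedLaw Pr L q γ.1.toMultiset =
    Pr {ω | ∀ y, occupation L y ω + (γ.visits y : ℝ≥0∞) = (q y : ℝ≥0∞)} := rfl
  rw [h2]
  ring

/-- The counterpart of the bordered permanent is `α` times the sum over paths from `x` to `y`, of
which only the intermediate vertices count towards `q`; splitting off the first step gives its
recursion. -/
lemma IsLoopSoup.prob_occupation_eq [IsProbabilityMeasure Pr] (hP : ∀ x y, 0 ≤ P x y)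
    (hα : 0 ≤ α) (hL : IsLoopSoup Pr α P L) (q : V → ℕ) :
    Pr {ω | ∀ y, occupation L y ω = (q y : ℝ≥0∞)} =
      Pr {ω | ∀ y, occupation L y ω = 0} * ENNReal.ofReal (blockWeight α P q) := by
  have h := eq_blockWeight_of_recursion hα hP (fun q => shiftedLaw Pr L q 0)
    (fun x y q => ENNReal.ofReal α * ∑' l : List V,
      ENNReal.ofReal (pathWeight P x l y) * shiftedLaw Pr L q l) ?_ ?_ q
  · simpa [shiftedLaw] using h
  · intro q x hx
    simp only [hL.shiftedLaw_recursion, shiftedLaw_cons, if_pos hx]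
  · intro x y q
    rw [tsum_list, mul_add, ← mul_assoc, Finset.mul_sum]
    congr 1
    · rw [ENNReal.ofReal_mul hα]; rfl
    · refine Finset.sum_congr rfl fun z _ => ?_
      simp only [← Multiset.cons_coe, shiftedLaw_cons, pathWeight]
      split_ifs
      · simp_rw [ENNReal.ofReal_mul (hP x z), mul_assoc]
        rw [ENNReal.tsum_mul_left, mul_left_comm]
      · simp

lemma exists_visits_ne_zero (γ : UnrootedLoop P) : ∃ x, γ.visits x ≠ 0 := by
  by_contra! h
  have h1 := sum_visits γ
  have h2 := length_pos γ
  rw [Finset.sum_eq_zero fun x _ => h x] at h1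
  omega

lemma IsLoopSoup.prob_occupation_eq_zero (hP : ∀ x y, 0 ≤ P x y) (htrans : IsTransient P)
    (hα : 0 ≤ α) (hL : IsLoopSoup Pr α P L) :
    Pr {ω | ∀ y, occupation L y ω = 0} = ENNReal.ofReal ((1 - P).det ^ α) := by
  have := countable_unrootedLoop P
  have hν : (ENNReal.ofReal α • loopMeasure P) Set.univ =
      ENNReal.ofReal (α * ∑' n : ℕ, (P ^ (n + 1)).trace / (n + 1)) := by
    rw [Measure.smul_apply, loopMeasure_univ_eq hP htrans, smul_eq_mul, ENNReal.ofReal_mul hα]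
  have hnonneg : 0 ≤ ∑' n : ℕ, (P ^ (n + 1)).trace / (n + 1) :=
    tsum_nonneg fun n => div_nonneg
      (Finset.sum_nonneg fun x _ => matrix_pow_nonneg hP (n + 1) x x) (by positivity)
  rw [occupation_eq_markSum, IsPoissonPointProcess.prob_markSum_eq_zero hL
    (by rw [hν]; exact ENNReal.ofReal_ne_top) exists_visits_ne_zero, hν,
    ENNReal.toReal_ofReal (mul_nonneg hα hnonneg),
    det_one_sub_eq_exp hP (htrans.summable hP), ← Real.exp_mul]
  congr 2
  ring

lemma IsLoopSoup.real_prob_occupation_eq [IsProbabilityMeasure Pr] (hP : ∀ x y, 0 ≤ P x y)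
    (htrans : IsTransient P) (hα : 0 ≤ α) (hL : IsLoopSoup Pr α P L) (q : V → ℕ) :
    Pr.real {ω | ∀ x, occupation L x ω = (q x : ℝ≥0∞)} =
      (1 - P).det ^ α *
        (alphaPermanent α (blockMatrix P q) / ∏ x, (Nat.factorial (q x) : ℝ)) := by
  have hdet : 0 ≤ (1 - P).det ^ α := by
    rw [det_one_sub_eq_exp hP (htrans.summable hP)]
    positivity
  rw [measureReal_def, hL.prob_occupation_eq hP hα, hL.prob_occupation_eq_zero hP htrans hα,
    ENNReal.toReal_mul, ENNReal.toReal_ofReal hdet,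
    ENNReal.toReal_ofReal (blockWeight_nonneg hα hP q), blockWeight]

/-- Rooting at `x` turns the sum into `α * ∑ (P ^ n) x x` over `n ≥ 1`, at most `α` times the Green
function on the diagonal. -/
lemma tsum_visits_mul_loopMeasure_ne_top (hP : ∀ x y, 0 ≤ P x y) (htrans : IsTransient P)
    (x : V) :
    ∑' γ : UnrootedLoop P, (γ.visits x : ℝ≥0∞) * (ENNReal.ofReal α • loopMeasure P) {γ} ≠ ∞ := by
  have h1 := tsum_mass_mul_visits (P := P) (fun _ => 1) x
  have h2 := tsum_pathWeight_mul hP (fun _ => 1) x x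
  simp only [mul_one] at h1 h2
  have h3 : ∑' γ : UnrootedLoop P,
      (γ.visits x : ℝ≥0∞) * (ENNReal.ofReal α • loopMeasure P) {γ} =
      ENNReal.ofReal α * ∑' n : ℕ, ENNReal.ofReal ((P ^ (n + 1)) x x) := by
    rw [← h2, ← h1, ← ENNReal.tsum_mul_left]
    refine tsum_congr fun γ => ?_
    rw [Measure.smul_apply, loopMeasure_singleton, smul_eq_mul]
    ring
  rw [h3]
  refine ENNReal.mul_ne_top ENNReal.ofReal_ne_top (ne_top_of_le_ne_top (htrans x x).ne ?_)
  exact ENNReal.tsum_comp_le_tsum_of_injective Nat.succ_injective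
    fun n => ENNReal.ofReal ((P ^ n) x x)

end Soup

end LoopSoup

theorem theorem2 {V : Type*} [Fintype V] [DecidableEq V] (P : Matrix V V ℝ)
    (hP : LoopSoup.IsSubMarkovian P) (htrans : LoopSoup.IsTransient P) (α : ℝ) (hα : 0 < α)
    {Ω : Type*} [MeasurableSpace Ω] (Pr : MeasureTheory.Measure Ω)
    [MeasureTheory.IsProbabilityMeasure Pr]
    (L : Ω → MeasureTheory.Measure (LoopSoup.UnrootedLoop P)) (hL : LoopSoup.IsLoopSoup Pr α P L) :
    LoopSoup.IsPermanentalField Pr (LoopSoup.occupation L) α⁻¹ P ∧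
    ∀ q : V → ℕ, Pr.real {ω | ∀ x, LoopSoup.occupation L x ω = (q x : ENNReal)} =
      (1 - P).det ^ α *
        (LoopSoup.alphaPermanent α (LoopSoup.blockMatrix P q) / ∏ x, (Nat.factorial (q x) : ℝ)) := by
  open LoopSoup in
  have := countable_unrootedLoop P
  have hlaw := hL.real_prob_occupation_eq hP.1 htrans hα.le
  refine ⟨⟨fun x => ?_, ?_, fun q => by rw [inv_inv]; exact hlaw q⟩, hlaw⟩
  · rw [occupation_eq_markSum]
    exact IsPoissonPointProcess.measurable_markSum hL x
  · rw [occupation_eq_markSum]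
    exact IsPoissonPointProcess.ae_exists_nat_markSum hL smul_loopMeasure_singleton_ne_top
      (tsum_visits_mul_loopMeasure_ne_top hP.1 htrans)
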